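/- **Samelson theorem.** Let $G$ be a compact Lie group of even real dimension, with Lie algebra $\mathfrak g$ (the tangent space at $1$ with the bracket of left-invariant vector fields), let $\omega$ be a faithful smooth unitary matrix representation of $G$ and let $C>0$. Then $$g_{MN}=\tfrac1C\,\mathrm{Tr}\{\partial_M\omega\,\partial_N\omega^{-1}\}$$ is a smooth Riemannian metric on $G$ (the Killing metric). Let $f$ be the structure constants: for a $g$-orthonormal basis $e_A$ of $\mathfrak g$ and Hermitian generators $t_A=-ie_A$, $[t_A,t_B]=i f_{ABC}t_C$, i.e. $f(X,Y,Z)=-g([X,Y],Z)$; extend $f$ to a left-invariant tensor field on $G$. An almost Hermitian structure means a smooth tensor field $I$ of type $(1,1)$ with $I^2=-\mathbb 1$ and $g(I\cdot,\cdot)=-g(\cdot,I\cdot)$; it is called an integrable complex structure if its Nijenhuis tensor vanishes identically. 1. A left-invariant almost Hermitian structure $I$ on $G$ is integrable if and only if on $\mathfrak g$ $$f_{ABC}-I_{AD}I_{BE}f_{DEC}-I_{BD}I_{CE}f_{DEA}-I_{CD}I_{AE}f_{DEB}=0.\qquad(*)$$ 2. The tensor field $f$ is totally antisymmetric, and there is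 an affine connection $\nabla^B$, the Bismut connection with torsion $f$, given by $g(\nabla^B_XY,Z)=g(\nabla_XY,Z)+\frac12 f(Z,X,Y)$ with $\nabla$ the Levi-Civita connection of $g$. 3. $\mathfrak g$ has a Cartan subalgebra. For every Cartan subalgebra $\mathfrak t\subset\mathfrak g$, there is a choice of positive roots, and $\mathfrak t$ has a $g$-orthonormal basis $t_1,\dots,t_{2m}$ with an even number of elements. For every choice of positive roots (a set $P$ of roots that contains exactly one of $\alpha,-\alpha$ for each root $\alpha$, and contains $\alpha+\beta$ whenever $\alpha,\beta\in P$ and $\alpha+\beta$ is a root) and every such basis in any order, there is a unique left-invariant field $I$ of endomorphisms of the tangent spaces of $G$ whose value on $\mathfrak g$, extended complex-linearly to $\mathfrak g\otimes\mathbb C$, satisfies $$IE_\alpha=-iE_\alpha,\quad IE_{-\alpha}=iE_{-\alpha}\quad(\alpha\in P),\qquad It_{2k-1}=t_{2k},\quad It_{2k}=-t_{2k-1}\quad(1\le k\le m),$$ for all root vectors $E_{\pm\alpha}$ of the roots $\pm\alpha$. Here $E$ is a root vector of the root $\alpha$ if $[h,E]=\alpha(h)E$ for all $h=-it$, $t\in\mathfrak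 t$. This $I$ is an integrable complex structure on $(G,g)$, satisfies $(*)$, and is parallel for $\nabla^B$, i.e. $\nabla^B I=0$. In particular, every even-dimensional compact Lie group with the Killing metric carries a left-invariant integrable complex structure that is parallel for the Bismut connection with torsion $f$. -/

import Mathlib

open Bundle VectorField
open scoped Manifold ContDiff TensorProduct

noncomputable section

namespace Samelson

/-- The `d`-dimensional model space. -/
abbrev Model (d : ℕ) : Type := EuclideanSpace ℝ (Fin d)

section Geometry

/- Tensor calculus on a manifold `M` of dimension `d`. -/

variable {d : ℕ} {M : Type*} [TopologicalSpace M] [ChartedSpace (Model d) M]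
  [IsManifold (𝓡 d) ∞ M]

/-- Smooth Riemannian metrics on `M`. -/
abbrev Metric (d : ℕ) (M : Type*) [TopologicalSpace M] [ChartedSpace (Model d) M]
    [IsManifold (𝓡 d) ∞ M] :=
  ContMDiffRiemannianMetric (𝓡 d) ∞ (Model d) (fun x : M => TangentSpace (𝓡 d) x)

/-- Fields of endomorphisms of the tangent spaces, that is, (1,1)-tensor fields. -/
abbrev EndField (d : ℕ) (M : Type*) [TopologicalSpace M] [ChartedSpace (Model d) M] :=
  (x : M) → (TangentSpace (𝓡 d) x →L[ℝ] TangentSpace (𝓡 d) x)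

/-- Affine connections on `M`; `B Y x u` is the covariant derivative `(∇_u Y)(x)`. -/
abbrev Connection (d : ℕ) (M : Type*) [TopologicalSpace M] [ChartedSpace (Model d) M]
    [IsManifold (𝓡 d) ∞ M] :=
  CovariantDerivative (𝓡 d) (Model d) (fun x : M => TangentSpace (𝓡 d) x)

/-- The vector field `X` is differentiable at `x`. -/
def DiffField (X : (x : M) → TangentSpace (𝓡 d) x) (x : M) : Prop :=
  MDifferentiableAt (𝓡 d) (𝓡 d).tangent (fun y => (⟨y, X y⟩ : TangentBundle (𝓡 d) M)) x

/-- The Nijenhuis tensor `N(X,Y) = [X,Y] + J[JX,Y] + J[X,JY] - [JX,JY]` of `J`, evaluated on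
vector fields `X`, `Y` at the point `x`. -/
def nijenhuis (J : EndField d M) (X Y : (x : M) → TangentSpace (𝓡 d) x) (x : M) :
    TangentSpace (𝓡 d) x :=
  mlieBracket (𝓡 d) X Y x
    + J x (mlieBracket (𝓡 d) (fun y => J y (X y)) Y x)
    + J x (mlieBracket (𝓡 d) X (fun y => J y (Y y)) x)
    - mlieBracket (𝓡 d) (fun y => J y (X y)) (fun y => J y (Y y)) x

/-- The Nijenhuis tensor of `J` vanishes identically. -/
def NijenhuisVanishes (J : EndField d M) : Prop :=
  ∀ (x : M) (X Y : (x : M) → TangentSpace (𝓡 d) x),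
    DiffField X x → DiffField Y x → nijenhuis J X Y x = 0

/-- A smooth almost complex structure that is skew-symmetric for the metric
(`I_{MN} = - I_{NM}` and `I_M^N I_N^P = - δ_M^P`). -/
structure IsAlmostHermitian (g : Metric d M) (J : EndField d M) : Prop where
  smooth : ContMDiff (𝓡 d) ((𝓡 d).prod 𝓘(ℝ, Model d →L[ℝ] Model d)) ∞
    (fun x : M => TotalSpace.mk' (Model d →L[ℝ] Model d)
      (E := fun x : M => TangentSpace (𝓡 d) x →L[ℝ] TangentSpace (𝓡 d) x) x (J x))
  skew : ∀ (x : M) (u v : TangentSpace (𝓡 d) x), g.inner x (J x u) v = - g.inner x u (J x v)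
  sq : ∀ (x : M) (u : TangentSpace (𝓡 d) x), J x (J x u) = - u

/-- An integrable complex structure on `(M, g)`. -/
structure IsComplexStructure (g : Metric d M) (J : EndField d M) : Prop
    extends IsAlmostHermitian g J where
  integrable : NijenhuisVanishes J

/-- `D` is the Levi-Civita connection of `g`: metric and torsion free. -/
def IsLeviCivita (g : Metric d M) (D : Connection d M) : Prop :=
  letI : RiemannianBundle (fun x : M => TangentSpace (𝓡 d) x) := ⟨g.toRiemannianMetric⟩
  haveI : IsManifold (𝓡 d) 2 M := IsManifold.of_le (n := ∞) (by norm_cast)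
  D.IsMetricCompatible ∧ D.torsion = 0

/-- `B` is the Bismut connection of `g` with the totally antisymmetric torsion tensor `C`:
`g(∇ᴮ_u Y, w) = g(∇_u Y, w) + (1/2) C(w, u, Y)` for the Levi-Civita connection `∇`, i.e.
`G^M_{NP} = Γ^M_{NP} + (1/2) g^{MK} C_{KNP}`. -/
def IsBismutConnection (g : Metric d M)
    (C : (x : M) → TangentSpace (𝓡 d) x → TangentSpace (𝓡 d) x → TangentSpace (𝓡 d) x → ℝ)
    (B : Connection d M) : Prop :=
  (∀ (x : M) (u v w : TangentSpace (𝓡 d) x),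
    C x u v w = - C x v u w ∧ C x u v w = - C x u w v) ∧
  ∃ D : Connection d M, IsLeviCivita g D ∧
    ∀ (x : M) (Y : (x : M) → TangentSpace (𝓡 d) x), DiffField Y x →
      ∀ u w : TangentSpace (𝓡 d) x,
        g.inner x (B Y x u) w = g.inner x (D Y x u) w + (1 / 2) * C x w u (Y x)

/-- `J` is covariantly constant for the connection `B`, i.e. `∇_u (J Y) = J (∇_u Y)`. -/
def IsParallel (B : Connection d M) (J : EndField d M) : Prop :=
  ∀ (x : M) (Y : (x : M) → TangentSpace (𝓡 d) x), DiffField Y x →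
    ∀ u : TangentSpace (𝓡 d) x, B (fun y => J y (Y y)) x u = J x (B Y x u)

end Geometry

section Group

variable {d : ℕ} {G : Type*} [TopologicalSpace G] [ChartedSpace (Model d) G] [Group G]
  [LieGroup (𝓡 d) ∞ G]

/-- The Lie algebra of `G`: the tangent space at `1` with the bracket of left-invariant
vector fields. -/
abbrev Alg (d : ℕ) (G : Type*) [TopologicalSpace G] [ChartedSpace (Model d) G] [Group G] :=
  GroupLieAlgebra (𝓡 d) G

instance instLieGroupMin : LieGroup (𝓡 d) (minSmoothness ℝ 3) G :=
  LieGroup.of_le (n := ∞) (by simp; norm_cast)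

instance instManifold : IsManifold (𝓡 d) ∞ G := LieGroup.toContMDiffMul.toIsManifold

/-- The derivative `∂_u F` at `x` of a matrix-valued function, taken entry by entry. -/
def matrixDeriv {N : ℕ} (F : G → Matrix (Fin N) (Fin N) ℂ) (x : G) (u : TangentSpace (𝓡 d) x) :
    Matrix (Fin N) (Fin N) ℂ :=
  Matrix.of fun i j => mfderiv (𝓡 d) 𝓘(ℝ, ℂ) (fun y => F y i j) x u

/-- `ρ` is a faithful smooth unitary matrix representation of `G`. -/
structure IsFaithfulRep {N : ℕ} (ρ : G →* Matrix.unitaryGroup (Fin N) ℂ) : Prop where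
  injective : Function.Injective ρ
  smooth : ∀ i j : Fin N, ContMDiff (𝓡 d) 𝓘(ℝ, ℂ) ∞
    (fun x : G => (ρ x : Matrix (Fin N) (Fin N) ℂ) i j)

/-- `g` is the Killing metric `g_{MN} = (1/C) Tr (∂_M ω ∂_N ω⁻¹)` of the matrix
representation `ω = ρ x`. -/
def IsKillingMetric {N : ℕ} (ρ : G →* Matrix.unitaryGroup (Fin N) ℂ) (C : ℝ)
    (g : Metric d G) : Prop :=
  ∀ (x : G) (u v : TangentSpace (𝓡 d) x),
    ((g.inner x u v : ℝ) : ℂ) = (1 / (C : ℂ)) *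
      (matrixDeriv (fun y => (ρ y : Matrix (Fin N) (Fin N) ℂ)) x u *
        matrixDeriv (fun y => ((ρ y)⁻¹ : Matrix.unitaryGroup (Fin N) ℂ).1) x v).trace

/-- The structure constants `f(X,Y,Z) = - g([X,Y],Z)`. If `e_A` is an orthonormal basis of the
Lie algebra and `t_A = - i e_A` are the corresponding Hermitian generators, then
`f_{ABC} = f(e_A,e_B,e_C)` are the constants in `[t_A,t_B] = i f_{ABC} t_C`. -/
def structureConst (g : Metric d G) (X Y Z : Alg d G) : ℝ := - g.inner 1 ⁅X, Y⁆ Z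

/-- The left-invariant Maurer-Cartan form `T_x G → T_1 G`, the derivative at `x` of left
translation by `x⁻¹`. -/
def maurerCartan (x : G) (u : TangentSpace (𝓡 d) x) : Alg d G :=
  mfderiv (𝓡 d) (𝓡 d) (fun y : G => x⁻¹ * y) x u

/-- The left-invariant 3-tensor on `G` whose value at `1` is given by the structure constants. -/
def structureTensor (g : Metric d G) (x : G) (u v w : TangentSpace (𝓡 d) x) : ℝ :=
  structureConst g (maurerCartan x u) (maurerCartan x v) (maurerCartan x w)

/-- `J` commutes with the derivatives of all left translations. -/
def IsLeftInvariant (J : EndField d G) : Prop :=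
  ∀ (a x : G) (v : TangentSpace (𝓡 d) x),
    J (a * x) (mfderiv (𝓡 d) (𝓡 d) (fun y : G => a * y) x v)
      = mfderiv (𝓡 d) (𝓡 d) (fun y : G => a * y) x (J x v)

/-- The identity `f_{ABC} - I_{AD} I_{BE} f_{DEC} - I_{BD} I_{CE} f_{DEA} - I_{CD} I_{AE} f_{DEB} = 0`
for an endomorphism of the Lie algebra. -/
def StructureIdentity (g : Metric d G) (I : Alg d G →L[ℝ] Alg d G) : Prop :=
  ∀ X Y Z : Alg d G,
    structureConst g X Y Z - structureConst g (I X) (I Y) Z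
      - structureConst g (I Y) (I Z) X - structureConst g (I Z) (I X) Y = 0

/-- `E` in the complexified Lie algebra satisfies `[h,E] = α(h) E` for the elements `h = - i t`,
`t ∈ 𝔱`, that is, `[t,E] = i α(t) E`. (We identify `t` with the Hermitian element `- i t`.) -/
def IsRootVector (𝔱 : LieSubalgebra ℝ (Alg d G)) (α : 𝔱 →ₗ[ℝ] ℝ) (E : ℂ ⊗[ℝ] Alg d G) : Prop :=
  ∀ t : 𝔱, ⁅(1 : ℂ) ⊗ₜ[ℝ] (t : Alg d G), E⁆ = (Complex.I * (α t : ℂ)) • E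

/-- The roots of the Lie algebra with respect to `𝔱`. -/
def roots (𝔱 : LieSubalgebra ℝ (Alg d G)) : Set (𝔱 →ₗ[ℝ] ℝ) :=
  {α | α ≠ 0 ∧ ∃ E : ℂ ⊗[ℝ] Alg d G, E ≠ 0 ∧ IsRootVector 𝔱 α E}

/-- `P` is a choice of positive roots. -/
structure IsPositiveSystem (𝔱 : LieSubalgebra ℝ (Alg d G)) (P : Set (𝔱 →ₗ[ℝ] ℝ)) : Prop where
  subset : P ⊆ roots 𝔱
  dichotomy : ∀ α ∈ roots 𝔱, Xor (α ∈ P) (-α ∈ P)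
  add_mem : ∀ α ∈ P, ∀ β ∈ P, α + β ∈ roots 𝔱 → α + β ∈ P

/-- The vectors `b (k,0), b (k,1)` form an orthonormal basis of `𝔱`, arranged in pairs. -/
def IsOrthonormalPairs (g : Metric d G) {𝔱 : LieSubalgebra ℝ (Alg d G)} {m : ℕ}
    (b : Module.Basis (Fin m × Fin 2) ℝ 𝔱) : Prop :=
  ∀ p q, g.inner 1 (b p : Alg d G) (b q : Alg d G) = if p = q then 1 else 0

/-- The prescription that defines the complex structure on the Lie algebra:
`I E_α = - i E_α`, `I E_{-α} = i E_{-α}` for `α` positive, and `I t_{k,0} = t_{k,1}`,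
`I t_{k,1} = - t_{k,0}` for the chosen basis of the Cartan subalgebra. -/
structure HasSamelsonAction {𝔱 : LieSubalgebra ℝ (Alg d G)} (P : Set (𝔱 →ₗ[ℝ] ℝ)) {m : ℕ}
    (b : Module.Basis (Fin m × Fin 2) ℝ 𝔱) (I : Alg d G →L[ℝ] Alg d G) : Prop where
  pos : ∀ α ∈ P, ∀ E, IsRootVector 𝔱 α E →
    (I : Alg d G →ₗ[ℝ] Alg d G).baseChange ℂ E = (-Complex.I) • E
  neg : ∀ α ∈ P, ∀ E, IsRootVector 𝔱 (-α) E →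
    (I : Alg d G →ₗ[ℝ] Alg d G).baseChange ℂ E = Complex.I • E
  fst : ∀ k, I (b (k, 0)) = b (k, 1)
  snd : ∀ k, I (b (k, 1)) = -(b (k, 0) : Alg d G)

end Group

end Samelson

end

/-! Differentiating `ρ` at the identity maps the Lie algebra to skew-Hermitian matrices, injectively
because `ρ` is faithful (`IsFaithfulRep.repDeriv_injective`). The trace form is therefore an
ad-invariant inner product κ, and its left translates form the Killing metric. What remains is
algebra on the Lie algebra with κ, carried to the group by left-invariant fields.

Algebra: each `ad x` is κ-skew, hence semisimple, so a Cartan subalgebra 𝔱 is abelian and the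
complexification is the sum of 𝔱_ℂ and the root spaces. An endomorphism `I` with `I² = -1` is
determined by its (-i)-eigenspace {X + i I X}; skewness of `I` says that this space is isotropic for
the complex bilinear extension of κ, and vanishing of the Nijenhuis expression says that it is a
subalgebra. The eigenspace prescribed here is the sum of the positive root spaces and of the span of
the vectors t_{2k-1} + i t_{2k} in 𝔱_ℂ. It is a subalgebra because positive roots are closed under
addition and 𝔱 is abelian (`samelsonGraph_lie`), and isotropic because two positive roots never add
to zero (`samelsonGraph_inner_eq`). Complex vectors are stored as pairs (real part, imaginary part),
so the eigenspace is literally the graph of `I`. Isotropy makes the projection to the first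
component injective and the root decomposition makes it surjective, which gives existence and
uniqueness. With the root spaces alone, the same graph puts a complex structure on the orthogonal
complement of 𝔱, so the rank has the parity of the dimension (`even_finrank_cartan`).

Geometry: the connection that makes left-invariant fields parallel is the Bismut connection, since
the Levi-Civita connection differs from it by half the bracket (`isLeviCivita_halfConnection`,
`isBismutConnection_leftConnection`). Hence every left-invariant `J` is parallel. The Nijenhuis
tensor is tensorial, so it may be tested on left-invariant fields, where it becomes an expression in
the Lie algebra (`IsLeftInvariant.nijenhuisVanishes_iff`); pairing that with κ gives the structure
identity (`structureIdentity_iff`). -/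

namespace Samelson

/-! ### Lie algebras with an invariant inner product. -/

section InvariantForm

/-- An invariant inner product on a real Lie algebra. -/
structure IsInvariantInner {L : Type*} [LieRing L] [LieAlgebra ℝ L]
    (κ : LinearMap.BilinForm ℝ L) : Prop where
  symm : ∀ x y, κ x y = κ y x
  pos : ∀ x, x ≠ 0 → 0 < κ x x
  inv : ∀ x y z : L, κ ⁅x, y⁆ z = - κ y ⁅x, z⁆

variable {L : Type*} [LieRing L] [LieAlgebra ℝ L] {κ : LinearMap.BilinForm ℝ L}

theorem IsInvariantInner.eq_zero (h : IsInvariantInner κ) {x : L} (hx : κ x x = 0) : x = 0 := by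
  by_contra hne
  exact (h.pos x hne).ne' hx

theorem IsInvariantInner.nonneg (h : IsInvariantInner κ) (x : L) : 0 ≤ κ x x := by
  by_cases hx : x = 0
  · simp [hx]
  · exact (h.pos x hx).le

theorem IsInvariantInner.isRefl (h : IsInvariantInner κ) : κ.IsRefl := fun x y hxy => by
  rw [h.symm, hxy]

/-- Since `ad x` is skew, the orthogonal complement of an invariant subspace is invariant;
definiteness makes it a complement. -/
theorem IsInvariantInner.isSemisimple_ad [FiniteDimensional ℝ L] (h : IsInvariantInner κ) (x : L) :
    (LieAlgebra.ad ℝ L x).IsSemisimple := by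
  rw [Module.End.isSemisimple_iff]
  intro p hp
  refine ⟨κ.orthogonal p, ?_, ?_⟩
  · intro y hy z hz
    have h1 := hy _ (hp hz)
    have h2 := h.inv x z y
    simp only [LieAlgebra.ad_apply] at h1 ⊢
    have h3 : κ ⁅x, z⁆ y = 0 := h1
    change κ z ⁅x, y⁆ = 0
    linarith
  · rw [LinearMap.BilinForm.isCompl_orthogonal_iff_disjoint h.isRefl, Submodule.disjoint_def]
    intro y hy hy'
    exact h.eq_zero (hy' y hy)

/-- For a semisimple operator the generalized kernel equals the kernel. -/
theorem IsInvariantInner.lie_eq_zero_of_pow [FiniteDimensional ℝ L] (h : IsInvariantInner κ)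
    (x y : L) (n : ℕ) (hn : ((LieAlgebra.ad ℝ L x) ^ n) y = 0) : ⁅x, y⁆ = 0 := by
  have h1 := (h.isSemisimple_ad x).isFinitelySemisimple.maxGenEigenspace_eq_eigenspace 0
  have h2 : y ∈ (LieAlgebra.ad ℝ L x).maxGenEigenspace 0 := by
    rw [Module.End.mem_maxGenEigenspace]
    exact ⟨n, by simpa using hn⟩
  rw [h1, Module.End.mem_eigenspace_iff] at h2
  simpa using h2

/-- Such an `x` normalizes the Cartan subalgebra, which is its own normalizer. -/
theorem mem_cartan_of_lie_eq_zero {𝔱 : LieSubalgebra ℝ L} (h𝔱 : 𝔱.IsCartanSubalgebra)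
    {x : L} (hx : ∀ t ∈ 𝔱, ⁅t, x⁆ = 0) : x ∈ 𝔱 := by
  rw [← h𝔱.self_normalizing, LieSubalgebra.mem_normalizer_iff']
  intro y hy
  rw [hx y hy]
  exact 𝔱.zero_mem

variable [FiniteDimensional ℝ L] {𝔱 : LieSubalgebra ℝ L}

/-- Nilpotency of 𝔱 makes `ad x` nilpotent on 𝔱; being semisimple, it vanishes there. -/
theorem IsInvariantInner.cartan_lie_eq_zero (h : IsInvariantInner κ) (h𝔱 : 𝔱.IsCartanSubalgebra)
    {x y : L} (hx : x ∈ 𝔱) (hy : y ∈ 𝔱) : ⁅x, y⁆ = 0 := by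
  have := h𝔱.nilpotent
  obtain ⟨k, hk⟩ := LieModule.exists_forall_pow_toEnd_eq_zero ℝ 𝔱 𝔱
  refine h.lie_eq_zero_of_pow x y k ?_
  have h1 : ∀ n : ℕ, (((LieModule.toEnd ℝ 𝔱 𝔱 ⟨x, hx⟩) ^ n) ⟨y, hy⟩ : L)
      = ((LieAlgebra.ad ℝ L x) ^ n) y := by
    intro n
    induction n with
    | zero => simp
    | succ n ih => rw [pow_succ', pow_succ', Module.End.mul_apply, Module.End.mul_apply, ← ih]; simp
  rw [← h1, hk]
  simp

end InvariantForm

/-! ### Complexifications through real and imaginary parts. -/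

section RealPart

variable {V W : Type*} [AddCommGroup V] [Module ℝ V] [AddCommGroup W] [Module ℝ W]

/-- The real part of a vector of a complexification. -/
noncomputable def tensorRe : ℂ ⊗[ℝ] V →ₗ[ℝ] V :=
  (TensorProduct.lid ℝ V).toLinearMap ∘ₗ LinearMap.rTensor V Complex.reLm

/-- The imaginary part of a vector of a complexification. -/
noncomputable def tensorIm : ℂ ⊗[ℝ] V →ₗ[ℝ] V :=
  (TensorProduct.lid ℝ V).toLinearMap ∘ₗ LinearMap.rTensor V Complex.imLm

@[simp] theorem tensorRe_tmul (z : ℂ) (v : V) : tensorRe (z ⊗ₜ[ℝ] v) = z.re • v := by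
  simp [tensorRe]

@[simp] theorem tensorIm_tmul (z : ℂ) (v : V) : tensorIm (z ⊗ₜ[ℝ] v) = z.im • v := by
  simp [tensorIm]

theorem tmul_re_add_tmul_im (E : ℂ ⊗[ℝ] V) :
    (1 : ℂ) ⊗ₜ[ℝ] tensorRe E + Complex.I ⊗ₜ[ℝ] tensorIm E = E := by
  induction E with
  | zero => simp
  | tmul z v =>
    rw [tensorRe_tmul, tensorIm_tmul, TensorProduct.tmul_smul, TensorProduct.tmul_smul,
      TensorProduct.smul_tmul', TensorProduct.smul_tmul', ← TensorProduct.add_tmul]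
    congr 1
    apply Complex.ext <;> simp
  | add a b ha hb =>
    nth_rw 3 [← ha]; nth_rw 3 [← hb]
    simp only [map_add, TensorProduct.tmul_add]
    abel

theorem tensor_ext_iff {E F : ℂ ⊗[ℝ] V} :
    E = F ↔ tensorRe E = tensorRe F ∧ tensorIm E = tensorIm F := by
  refine ⟨fun h => by simp [h], fun ⟨h1, h2⟩ => ?_⟩
  rw [← tmul_re_add_tmul_im E, ← tmul_re_add_tmul_im F, h1, h2]

theorem tensorRe_smul (c : ℂ) (E : ℂ ⊗[ℝ] V) :
    tensorRe (c • E) = c.re • tensorRe E - c.im • tensorIm E := by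
  induction E with
  | zero => simp
  | tmul z v => simp [TensorProduct.smul_tmul', sub_smul, mul_smul]
  | add a b ha hb => simp only [smul_add, map_add, ha, hb]; abel

theorem tensorIm_smul (c : ℂ) (E : ℂ ⊗[ℝ] V) :
    tensorIm (c • E) = c.re • tensorIm E + c.im • tensorRe E := by
  induction E with
  | zero => simp
  | tmul z v => simp [TensorProduct.smul_tmul', add_smul, mul_smul]
  | add a b ha hb => simp only [smul_add, map_add, ha, hb]; abel

theorem tensorRe_baseChange (f : V →ₗ[ℝ] W) (E : ℂ ⊗[ℝ] V) :
    tensorRe (f.baseChange ℂ E) = f (tensorRe E) := by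
  induction E with
  | zero => simp
  | tmul z v => simp
  | add a b ha hb => simp only [map_add, ha, hb]

theorem tensorIm_baseChange (f : V →ₗ[ℝ] W) (E : ℂ ⊗[ℝ] V) :
    tensorIm (f.baseChange ℂ E) = f (tensorIm E) := by
  induction E with
  | zero => simp
  | tmul z v => simp
  | add a b ha hb => simp only [map_add, ha, hb]

theorem one_tmul_lie {L : Type*} [LieRing L] [LieAlgebra ℝ L] (x : L) (E : ℂ ⊗[ℝ] L) :
    ⁅(1 : ℂ) ⊗ₜ[ℝ] x, E⁆ = (LieAlgebra.ad ℝ L x).baseChange ℂ E := by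
  induction E with
  | zero => exact (lie_zero (L := ℂ ⊗[ℝ] L) (M := ℂ ⊗[ℝ] L) _).trans (map_zero _).symm
  | tmul z v => simp [LieAlgebra.ExtendScalars.bracket_tmul]
  | add a b ha hb =>
    rw [map_add, ← ha, ← hb]
    exact lie_add (L := ℂ ⊗[ℝ] L) (M := ℂ ⊗[ℝ] L) _ a b

/-- The minimal polynomial is squarefree, hence separable in characteristic zero, so it stays
squarefree over ℂ; it still annihilates the complexified map. -/
theorem isSemisimple_baseChange [FiniteDimensional ℝ V] {f : Module.End ℝ V}
    (hf : f.IsSemisimple) : Module.End.IsSemisimple (f.baseChange ℂ : Module.End ℂ (ℂ ⊗[ℝ] V)) := by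
  have h1 : (minpoly ℝ f).Separable := PerfectField.separable_iff_squarefree.2 hf.minpoly_squarefree
  have h2 : Squarefree ((minpoly ℝ f).map (algebraMap ℝ ℂ)) := (h1.map).squarefree
  refine Module.End.isSemisimple_of_squarefree_aeval_eq_zero h2 ?_
  rw [Polynomial.aeval_map_algebraMap]
  have h3 : ∀ p : Polynomial ℝ, Polynomial.aeval (f.baseChange ℂ : Module.End ℂ (ℂ ⊗[ℝ] V)) p
      = (Polynomial.aeval f p).baseChange ℂ := by
    intro p
    exact (Polynomial.aeval_algHom_apply (Module.End.baseChangeHom ℝ ℂ V) f p)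
  rw [h3, minpoly.aeval, LinearMap.baseChange_zero]

end RealPart

end Samelson

namespace Samelson

/-! ### Roots, positive systems and the root decomposition in real form. -/

section RootPairs

variable {L : Type*} [LieRing L] [LieAlgebra ℝ L] {κ : LinearMap.BilinForm ℝ L}
  {𝔱 : LieSubalgebra ℝ L}

/-- `X + i Y` is a root vector of the root `α`. -/
def IsRootPair (𝔱 : LieSubalgebra ℝ L) (α : 𝔱 →ₗ[ℝ] ℝ) (X Y : L) : Prop :=
  ∀ t : 𝔱, ⁅(t : L), X⁆ = -(α t • Y) ∧ ⁅(t : L), Y⁆ = α t • X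

/-- The real roots of a Lie algebra. -/
def rootSet (𝔱 : LieSubalgebra ℝ L) : Set (𝔱 →ₗ[ℝ] ℝ) :=
  {α | α ≠ 0 ∧ ∃ X Y, (X ≠ 0 ∨ Y ≠ 0) ∧ IsRootPair 𝔱 α X Y}

/-- The set `P` contains exactly one of each pair of opposite roots and is closed under addition
of roots. -/
structure IsPositiveRootSet (𝔱 : LieSubalgebra ℝ L) (P : Set (𝔱 →ₗ[ℝ] ℝ)) : Prop where
  subset : P ⊆ rootSet 𝔱
  dichotomy : ∀ α ∈ rootSet 𝔱, Xor (α ∈ P) (-α ∈ P)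
  add_mem : ∀ α ∈ P, ∀ β ∈ P, α + β ∈ rootSet 𝔱 → α + β ∈ P

variable {α β : 𝔱 →ₗ[ℝ] ℝ} {X Y X' Y' : L}

theorem IsRootPair.rotate (h : IsRootPair 𝔱 α X Y) : IsRootPair 𝔱 α Y (-X) := fun t => by
  rw [lie_neg, (h t).1, (h t).2]; simp

theorem IsRootPair.conj (h : IsRootPair 𝔱 α X Y) : IsRootPair 𝔱 (-α) X (-Y) := fun t => by
  rw [lie_neg, (h t).1, (h t).2]; simp

theorem IsRootPair.lie (h : IsRootPair 𝔱 α X Y) (h' : IsRootPair 𝔱 β X' Y') :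
    IsRootPair 𝔱 (α + β) (⁅X, X'⁆ - ⁅Y, Y'⁆) (⁅X, Y'⁆ + ⁅Y, X'⁆) := fun t => by
  constructor
  · rw [lie_sub, leibniz_lie, leibniz_lie (t : L) Y, (h t).1, (h t).2, (h' t).1, (h' t).2]
    simp only [neg_lie, lie_neg, smul_lie, lie_smul, LinearMap.add_apply]
    module
  · rw [lie_add, leibniz_lie, leibniz_lie (t : L) Y, (h t).1, (h t).2, (h' t).1, (h' t).2]
    simp only [neg_lie, lie_neg, smul_lie, lie_smul, LinearMap.add_apply]
    module

theorem neg_mem_rootSet (h : α ∈ rootSet 𝔱) : -α ∈ rootSet 𝔱 := by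
  obtain ⟨h0, X, Y, hXY, hp⟩ := h
  exact ⟨neg_ne_zero.2 h0, X, -Y, by simpa using hXY, hp.conj⟩

theorem IsPositiveRootSet.add_ne_zero {P : Set (𝔱 →ₗ[ℝ] ℝ)} (hP : IsPositiveRootSet 𝔱 P)
    (hα : α ∈ P) (hβ : β ∈ P) : α + β ≠ 0 := by
  intro h
  have h1 : β = -α := by rw [eq_neg_iff_add_eq_zero, add_comm, h]
  rcases hP.dichotomy α (hP.subset hα) with h2 | h2
  · exact h2.2 (h1 ▸ hβ)
  · exact h2.2 hα

/-- Comparing values on a basis of 𝔱 lexicographically totally orders the dual space compatibly with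
addition; the roots above zero form a positive system. -/
theorem exists_isPositiveRootSet [FiniteDimensional ℝ L] (𝔱 : LieSubalgebra ℝ L) :
    ∃ P, IsPositiveRootSet 𝔱 P := by
  let B := Module.finBasis ℝ 𝔱
  let ev : (𝔱 →ₗ[ℝ] ℝ) → Lex (Fin (Module.finrank ℝ 𝔱) → ℝ) := fun α => toLex fun i => α (B i)
  have ev_add : ∀ α β, ev (α + β) = ev α + ev β := fun α β => rfl
  have ev_neg : ∀ α, ev (-α) = - ev α := fun α => rfl
  have ev_zero : ∀ α, ev α = 0 → α = 0 := fun α h => B.ext fun i => congrFun (ofLex_inj.2 h) i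
  refine ⟨{α | α ∈ rootSet 𝔱 ∧ 0 < ev α}, fun α h => h.1, fun α h => ?_, ?_⟩
  · have hn := neg_mem_rootSet h
    rcases lt_trichotomy 0 (ev α) with h1 | h1 | h1
    · refine Or.inl ⟨⟨h, h1⟩, fun h2 => ?_⟩
      have h3 := h2.2
      rw [ev_neg, Left.neg_pos_iff] at h3
      exact lt_asymm h1 h3
    · exact absurd (ev_zero α h1.symm) h.1
    · refine Or.inr ⟨⟨hn, ?_⟩, fun h2 => lt_asymm h1 h2.2⟩
      rw [ev_neg, Left.neg_pos_iff]
      exact h1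
  · intro α hα β hβ h
    refine ⟨h, ?_⟩
    rw [ev_add]
    exact add_pos hα.2 hβ.2

variable [FiniteDimensional ℝ L]

/-- The commuting semisimple operators `ad t` are simultaneously diagonalizable over ℂ. Skewness
forces imaginary eigenvalues, so a joint eigenvector is a root vector or, for the zero weight,
centralizes 𝔱. Real parts of joint eigenvectors span. -/
theorem IsInvariantInner.mem_sup_span_rootPairs (h : IsInvariantInner κ)
    (h𝔱 : 𝔱.IsCartanSubalgebra) (X : L) :
    X ∈ 𝔱.toSubmodule ⊔ Submodule.span ℝ {X | ∃ α ≠ 0, ∃ Y, IsRootPair 𝔱 α X Y} := by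
  set S := 𝔱.toSubmodule ⊔ Submodule.span ℝ {X | ∃ α ≠ 0, ∃ Y, IsRootPair 𝔱 α X Y} with hS
  let A : 𝔱 → Module.End ℂ (ℂ ⊗[ℝ] L) := fun t => (LieAlgebra.ad ℝ L (t : L)).baseChange ℂ
  have hss : ∀ t, (A t).IsSemisimple := fun t => isSemisimple_baseChange (h.isSemisimple_ad _)
  have hcomm : Pairwise fun s t => Commute (A s) (A t) := by
    intro s t _
    have h1 : Commute (LieAlgebra.ad ℝ L (s : L)) (LieAlgebra.ad ℝ L (t : L)) := by
      refine LinearMap.ext fun x => ?_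
      simp [leibniz_lie (s : L) (t : L) x, h.cartan_lie_eq_zero h𝔱 s.2 t.2]
    exact h1.map (Module.End.baseChangeHom ℝ ℂ L)
  have htop := Module.End.iSup_iInf_maxGenEigenspace_eq_top_of_iSup_maxGenEigenspace_eq_top_of_commute
    A hcomm (fun t => Module.End.iSup_maxGenEigenspace_eq_top (A t))
  have key : ∀ E : ℂ ⊗[ℝ] L, tensorRe E ∈ S := by
    intro E
    have hE : E ∈ ⨆ χ : 𝔱 → ℂ, ⨅ i, (A i).maxGenEigenspace (χ i) := htop ▸ Submodule.mem_top
    refine Submodule.iSup_induction _ (motive := fun E => tensorRe E ∈ S) hE ?_ (by simp) ?_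
    · intro χ E hE
      by_cases hE0 : E = 0
      · simp [hE0]
      have h1 : ∀ t : 𝔱, A t E = χ t • E := by
        intro t
        have h2 := (Submodule.mem_iInf _).1 hE t
        rw [(hss t).isFinitelySemisimple.maxGenEigenspace_eq_eigenspace,
          Module.End.mem_eigenspace_iff] at h2
        exact h2
      set X := tensorRe E with hX
      set Y := tensorIm E with hY
      have hre : ∀ t : 𝔱, ⁅(t : L), X⁆ = (χ t).re • X - (χ t).im • Y := by
        intro t
        have h2 := congrArg tensorRe (h1 t)
        rwa [tensorRe_smul, tensorRe_baseChange, LieAlgebra.ad_apply] at h2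
      have him : ∀ t : 𝔱, ⁅(t : L), Y⁆ = (χ t).re • Y + (χ t).im • X := by
        intro t
        have h2 := congrArg tensorIm (h1 t)
        rwa [tensorIm_smul, tensorIm_baseChange, LieAlgebra.ad_apply] at h2
      have hXY : 0 < κ X X + κ Y Y := by
        by_contra hcon
        have hx0 := h.eq_zero (x := X) (by linarith [h.nonneg X, h.nonneg Y])
        have hy0 := h.eq_zero (x := Y) (by linarith [h.nonneg X, h.nonneg Y])
        apply hE0
        rw [← tmul_re_add_tmul_im E, ← hX, ← hY, hx0, hy0]
        simp
      have hskew : ∀ x y : L, κ ⁅x, y⁆ y = 0 := by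
        intro x y
        have := h.inv x y y
        rw [h.symm y] at this
        linarith
      have hre0 : ∀ t, (χ t).re = 0 := by
        intro t
        have h2 := hskew t X
        have h3 := hskew t Y
        rw [hre] at h2
        rw [him] at h3
        simp only [map_sub, map_add, map_smul, LinearMap.sub_apply, LinearMap.add_apply,
          LinearMap.smul_apply, smul_eq_mul] at h2 h3
        rw [h.symm Y X] at h2
        have h4 : (χ t).re * (κ X X + κ Y Y) = 0 := by linarith
        exact (mul_eq_zero.1 h4).resolve_right hXY.ne'
      simp only [hre0, zero_smul, zero_sub, zero_add] at hre him
      -- The joint eigenvalue `χ` is a priori only a function on 𝔱. Multiplied by the positive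
      -- number `κ X X + κ Y Y`, its imaginary part is visibly linear in `t`.
      have hval : ∀ t : 𝔱, (χ t).im * (κ X X + κ Y Y) = κ ⁅(t : L), Y⁆ X - κ ⁅(t : L), X⁆ Y := by
        intro t
        rw [hre, him]
        simp only [map_neg, map_smul, LinearMap.neg_apply, LinearMap.smul_apply, smul_eq_mul]
        ring
      let α : 𝔱 →ₗ[ℝ] ℝ :=
        { toFun := fun t => (χ t).im
          map_add' := fun s t => by
            apply mul_right_cancel₀ hXY.ne'
            have hst : ((s + t : 𝔱) : L) = s + t := rfl
            rw [add_mul, hval, hval, hval, hst]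
            simp only [add_lie, map_add, LinearMap.add_apply]
            ring
          map_smul' := fun c t => by
            apply mul_right_cancel₀ hXY.ne'
            have hct : ((c • t : 𝔱) : L) = c • (t : L) := rfl
            rw [RingHom.id_apply, smul_eq_mul, mul_assoc, hval, hval, hct]
            simp only [smul_lie, map_smul, LinearMap.smul_apply,
              smul_eq_mul]
            ring }
      by_cases hα : α = 0
      · refine Submodule.mem_sup_left (mem_cartan_of_lie_eq_zero h𝔱 fun t ht => ?_)
        have h2 : (χ ⟨t, ht⟩).im = 0 := LinearMap.congr_fun hα ⟨t, ht⟩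
        have h3 := hre ⟨t, ht⟩
        rw [h2] at h3
        simpa using h3
      · exact Submodule.mem_sup_right (Submodule.subset_span ⟨α, hα, Y, fun t => ⟨hre t, him t⟩⟩)
    · intro x y hx hy
      rw [map_add]
      exact S.add_mem hx hy
  simpa using key ((1 : ℂ) ⊗ₜ[ℝ] X)

end RootPairs

/-! ### The complex isotropic subalgebra attached to a positive system. -/

section SamelsonGraph

variable {L : Type*} [LieRing L] [LieAlgebra ℝ L] {κ : LinearMap.BilinForm ℝ L}
  {𝔱 : LieSubalgebra ℝ L} {P : Set (𝔱 →ₗ[ℝ] ℝ)} {T : Set (L × L)}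

/-- The span of the root pairs of the roots in `P` and of the pairs in `T`. -/
def samelsonGraph (P : Set (𝔱 →ₗ[ℝ] ℝ)) (T : Set (L × L)) : Submodule ℝ (L × L) :=
  Submodule.span ℝ ({p | ∃ α ∈ P, IsRootPair 𝔱 α p.1 p.2} ∪ T)

/-- With `(X, Y)` read as X + iY, the map `(X, Y) ↦ (Y, -X)` is multiplication by -i, so the graph
is a complex subspace. -/
theorem samelsonGraph_rotate (hT : ∀ p ∈ T, (p.2, -p.1) ∈ T) {p : L × L}
    (hp : p ∈ samelsonGraph P T) : (p.2, -p.1) ∈ samelsonGraph P T := by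
  induction hp using Submodule.span_induction with
  | mem p hp =>
    rcases hp with ⟨α, hα, hp⟩ | hp
    · exact Submodule.subset_span (Or.inl ⟨α, hα, hp.rotate⟩)
    · exact Submodule.subset_span (Or.inr (hT p hp))
  | zero => simp only [Prod.fst_zero, Prod.snd_zero, neg_zero]; exact (samelsonGraph P T).zero_mem
  | add p q _ _ hp hq =>
    have := Submodule.add_mem _ hp hq
    simpa [add_comm] using this
  | smul c p _ hp =>
    have := Submodule.smul_mem _ c hp
    simpa using this

/-- Write `α s • X` as `⁅s, Y⁆` and move `s` across κ onto `t`, which it commutes with. -/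
theorem IsRootPair.inner_cartan (h : IsInvariantInner κ) (hab : ∀ x ∈ 𝔱, ∀ y ∈ 𝔱, ⁅x, y⁆ = 0)
    {α : 𝔱 →ₗ[ℝ] ℝ} (hα : α ≠ 0) {X Y : L} (hp : IsRootPair 𝔱 α X Y) {t : L} (ht : t ∈ 𝔱) :
    κ t X = 0 := by
  obtain ⟨s, hs⟩ : ∃ s, α s ≠ 0 := by
    by_contra! hcon
    exact hα (LinearMap.ext hcon)
  have h1 : α s * κ t X = κ t ⁅(s : L), Y⁆ := by rw [(hp s).2]; simp
  have h2 := h.inv s t Y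
  rw [hab s s.2 t ht, map_zero, LinearMap.zero_apply] at h2
  rw [neg_eq_zero.1 h2.symm] at h1
  exact (mul_eq_zero.1 h1).resolve_left hs

/-- The difference of the two sides is the real part of the complex bilinear κ on two root vectors.
Invariance under `s` multiplies it by `(α + β) s`, so it must vanish. -/
theorem IsRootPair.inner_eq (h : IsInvariantInner κ) {α β : 𝔱 →ₗ[ℝ] ℝ} (hαβ : α + β ≠ 0)
    {X Y X' Y' : L} (hp : IsRootPair 𝔱 α X Y) (hq : IsRootPair 𝔱 β X' Y') :
    κ X X' = κ Y Y' := by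
  obtain ⟨s, hs⟩ : ∃ s, (α + β) s ≠ 0 := by
    by_contra! hcon
    exact hαβ (LinearMap.ext hcon)
  have h1 := h.inv s X Y'
  have h2 := h.inv s Y X'
  rw [(hp s).1, (hq s).2] at h1
  rw [(hp s).2, (hq s).1] at h2
  simp only [map_neg, map_smul, LinearMap.neg_apply, LinearMap.smul_apply, smul_eq_mul] at h1 h2
  rw [LinearMap.add_apply] at hs
  have h3 : (α s + β s) * (κ X X' - κ Y Y') = 0 := by linarith
  linarith [(mul_eq_zero.1 h3).resolve_left hs]

/-- This is isotropy of the graph: positive root spaces are mutually isotropic because sums of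
positive roots are nonzero, they are orthogonal to 𝔱, and `T` is isotropic by assumption. -/
theorem samelsonGraph_inner_eq (h : IsInvariantInner κ) (hab : ∀ x ∈ 𝔱, ∀ y ∈ 𝔱, ⁅x, y⁆ = 0)
    (hP : IsPositiveRootSet 𝔱 P) (hT : ∀ p ∈ T, p.1 ∈ 𝔱 ∧ p.2 ∈ 𝔱)
    (hTκ : ∀ p ∈ T, ∀ q ∈ T, κ p.1 q.1 = κ p.2 q.2) {p q : L × L}
    (hp : p ∈ samelsonGraph P T) (hq : q ∈ samelsonGraph P T) : κ p.1 q.1 = κ p.2 q.2 := by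
  induction hp, hq using Submodule.span_induction₂ with
  | mem_mem p q hp hq =>
    rcases hp with ⟨α, hα, hp⟩ | hp <;> rcases hq with ⟨β, hβ, hq⟩ | hq
    · exact hp.inner_eq h (hP.add_ne_zero hα hβ) hq
    · rw [h.symm, hp.inner_cartan h hab (hP.subset hα).1 (hT q hq).1, h.symm,
        hp.rotate.inner_cartan h hab (hP.subset hα).1 (hT q hq).2]
    · rw [hq.inner_cartan h hab (hP.subset hβ).1 (hT p hp).1,
        hq.rotate.inner_cartan h hab (hP.subset hβ).1 (hT p hp).2]
    · exact hTκ p hp q hq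
  | zero_left | zero_right => simp
  | add_left | add_right => simp_all
  | smul_left | smul_right => simp_all

/-- The displayed pair is the bracket of p.1 + i p.2 and q.1 + i q.2, so the claim is that the graph
is a subalgebra. -/
theorem samelsonGraph_lie (hab : ∀ x ∈ 𝔱, ∀ y ∈ 𝔱, ⁅x, y⁆ = 0)
    (hP : IsPositiveRootSet 𝔱 P) (hT : ∀ p ∈ T, p.1 ∈ 𝔱 ∧ p.2 ∈ 𝔱) {p q : L × L}
    (hp : p ∈ samelsonGraph P T) (hq : q ∈ samelsonGraph P T) :
    (⁅p.1, q.1⁆ - ⁅p.2, q.2⁆, ⁅p.1, q.2⁆ + ⁅p.2, q.1⁆) ∈ samelsonGraph P T := by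
  -- An element t + is of the complexified Cartan subalgebra acts on a root vector by the scalar
  -- iα(t) - α(s); the first summand is written through the rotated pair.
  have mixed : ∀ p ∈ T, ∀ α ∈ P, ∀ q : L × L, IsRootPair 𝔱 α q.1 q.2 →
      (⁅p.1, q.1⁆ - ⁅p.2, q.2⁆, ⁅p.1, q.2⁆ + ⁅p.2, q.1⁆) ∈ samelsonGraph P T := by
    intro p hp α hα q hq
    have h1 : q ∈ samelsonGraph P T := Submodule.subset_span (Or.inl ⟨α, hα, hq⟩)
    have h2 : (q.2, -q.1) ∈ samelsonGraph P T := Submodule.subset_span (Or.inl ⟨α, hα, hq.rotate⟩)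
    have h3 := Submodule.sub_mem _ (Submodule.smul_mem _ (-α ⟨p.1, (hT p hp).1⟩) h2)
      (Submodule.smul_mem _ (α ⟨p.2, (hT p hp).2⟩) h1)
    convert h3 using 1
    have e1 := hq ⟨p.1, (hT p hp).1⟩
    have e2 := hq ⟨p.2, (hT p hp).2⟩
    simp only at e1 e2
    rw [e1.1, e1.2, e2.1, e2.2]
    ext <;> simp [sub_eq_add_neg]
  induction hp, hq using Submodule.span_induction₂ with
  | mem_mem p q hp hq =>
    rcases hp with ⟨α, hα, hp⟩ | hp <;> rcases hq with ⟨β, hβ, hq⟩ | hq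
    · have h1 := hp.lie hq
      -- A nonzero bracket is a root vector of `α + β`, which is then a root and so belongs to `P`.
      by_cases h0 : (⁅p.1, q.1⁆ - ⁅p.2, q.2⁆, ⁅p.1, q.2⁆ + ⁅p.2, q.1⁆) = (0 : L × L)
      · rw [h0]; exact Submodule.zero_mem _
      · refine Submodule.subset_span (Or.inl ⟨α + β, hP.add_mem α hα β hβ
          ⟨hP.add_ne_zero hα hβ, _, _, ?_, h1⟩, h1⟩)
        by_contra! hcon
        exact h0 (Prod.ext hcon.1 hcon.2)
    · have h1 := Submodule.neg_mem _ (mixed q hq α hα p hp)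
      convert h1 using 1
      ext
      · simp only [Prod.fst_neg]
        rw [← lie_skew, ← lie_skew q.2 p.2]
        abel
      · simp only [Prod.snd_neg]
        rw [← lie_skew, ← lie_skew q.1 p.2]
        abel
    · exact mixed p hp β hβ q hq
    · rw [hab _ (hT p hp).1 _ (hT q hq).1, hab _ (hT p hp).1 _ (hT q hq).2,
        hab _ (hT p hp).2 _ (hT q hq).1, hab _ (hT p hp).2 _ (hT q hq).2, sub_zero, add_zero]
      exact (samelsonGraph P T).zero_mem
  | zero_left | zero_right =>
    simp only [Prod.fst_zero, Prod.snd_zero, zero_lie, lie_zero, sub_zero, add_zero]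
    exact (samelsonGraph P T).zero_mem
  | add_left x y z _ _ _ h1 h2 =>
    convert Submodule.add_mem _ h1 h2 using 1
    ext <;> simp <;> abel
  | add_right x y z _ _ _ h1 h2 =>
    convert Submodule.add_mem _ h1 h2 using 1
    ext <;> simp <;> abel
  | smul_left c x y _ _ h1 =>
    convert Submodule.smul_mem _ c h1 using 1
    ext <;> simp [smul_sub]
  | smul_right c x y _ _ h1 =>
    convert Submodule.smul_mem _ c h1 using 1
    ext <;> simp [smul_sub]

end SamelsonGraph

end Samelson

namespace Samelson

/-! ### Complex structures and orthonormal bases on real vector spaces. -/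

section LinearAlgebra

/-- A finite-dimensional real vector space with a complex structure is even-dimensional. -/
theorem even_finrank_of_sq_eq_neg_one {V : Type*} [AddCommGroup V] [Module ℝ V]
    [FiniteDimensional ℝ V] (R : V →ₗ[ℝ] V) (hR : ∀ v, R (R v) = -v) :
    Even (Module.finrank ℝ V) := by
  -- Taking determinants gives (det R)² = (-1)^n, impossible for odd n.
  have h1 : R ∘ₗ R = (-1 : ℝ) • LinearMap.id := LinearMap.ext fun v => by simp [hR]
  have h2 := congrArg LinearMap.det h1
  rw [LinearMap.det_comp, LinearMap.det_smul, LinearMap.det_id, mul_one] at h2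
  by_contra hodd
  rw [(Nat.not_even_iff_odd.1 hodd).neg_one_pow] at h2
  linarith [mul_self_nonneg (LinearMap.det R)]

theorem exists_orthonormal_basis_of_posDef {V : Type*} [AddCommGroup V] [Module ℝ V]
    [FiniteDimensional ℝ V] (κ : LinearMap.BilinForm ℝ V) (hs : ∀ x y, κ x y = κ y x)
    (hp : ∀ x, x ≠ 0 → 0 < κ x x) {ι : Type*} [Fintype ι] [DecidableEq ι]
    (hι : Fintype.card ι = Module.finrank ℝ V) :
    ∃ b : Module.Basis ι ℝ V, ∀ i j, κ (b i) (b j) = if i = j then 1 else 0 := by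
  let core : InnerProductSpace.Core ℝ V :=
    { inner := fun x y => κ x y
      conj_inner_symm := fun x y => hs y x
      re_inner_nonneg := fun x => by
        by_cases hx : x = 0
        · simp [hx]
        · exact (hp x hx).le
      add_left := fun x y z => by simp
      smul_left := fun x y r => by simp
      definite := fun x hx => by
        by_contra hne
        exact (hp x hne).ne' hx }
  let _ : NormedAddCommGroup V := core.toNormedAddCommGroup
  let _ : InnerProductSpace ℝ V := InnerProductSpace.ofCore core.toCore
  let e : Fin (Module.finrank ℝ V) ≃ ι := (finCongr hι.symm).trans (Fintype.equivFin ι).symm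
  let b := (stdOrthonormalBasis ℝ V).reindex e
  refine ⟨b.toBasis, fun i j => ?_⟩
  have := orthonormal_iff_ite.1 b.orthonormal i j
  simpa using! this

end LinearAlgebra

/-! ### Parity of the rank and the complex structure on the Lie algebra. -/

section SamelsonStructure

variable {L : Type*} [LieRing L] [LieAlgebra ℝ L]
  {κ : LinearMap.BilinForm ℝ L} {𝔱 : LieSubalgebra ℝ L} {P : Set (𝔱 →ₗ[ℝ] ℝ)}

/-- For a negative root the conjugate pair, with the same real part, lies in the graph. -/
theorem rootPair_mem_map_fst (hP : IsPositiveRootSet 𝔱 P) (T : Set (L × L)) {α : 𝔱 →ₗ[ℝ] ℝ}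
    (hα : α ≠ 0) {X Y : L} (hp : IsRootPair 𝔱 α X Y) :
    X ∈ (samelsonGraph P T).map (LinearMap.fst ℝ L L) := by
  by_cases hX : X = 0
  · rw [hX]; exact Submodule.zero_mem _
  have hroot : α ∈ rootSet 𝔱 := ⟨hα, X, Y, Or.inl hX, hp⟩
  rcases hP.dichotomy α hroot with h1 | h1
  · exact ⟨(X, Y), Submodule.subset_span (Or.inl ⟨α, h1.1, hp⟩), rfl⟩
  · exact ⟨(X, -Y), Submodule.subset_span (Or.inl ⟨-α, h1.1, hp.conj⟩), rfl⟩

/-- The pairs `(t, I t)` for the elements `t` of a basis arranged in pairs. -/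
def torusPairs {m : ℕ} (b : Module.Basis (Fin m × Fin 2) ℝ 𝔱) : Set (L × L) :=
  {p | ∃ k, p = ((b (k, 0) : L), (b (k, 1) : L)) ∨ p = ((b (k, 1) : L), -(b (k, 0) : L)) ∨
    p = (-(b (k, 0) : L), -(b (k, 1) : L)) ∨ p = (-(b (k, 1) : L), (b (k, 0) : L))}

/-- The endomorphism `J` acts on root pairs and on the basis `b` by the Samelson prescription. -/
structure IsSamelson (P : Set (𝔱 →ₗ[ℝ] ℝ)) {m : ℕ} (b : Module.Basis (Fin m × Fin 2) ℝ 𝔱)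
    (J : L →ₗ[ℝ] L) : Prop where
  root : ∀ α ∈ P, ∀ X Y, IsRootPair 𝔱 α X Y → J X = Y
  fst : ∀ k, J (b (k, 0)) = b (k, 1)
  snd : ∀ k, J (b (k, 1)) = -(b (k, 0) : L)

variable {m : ℕ} {b : Module.Basis (Fin m × Fin 2) ℝ 𝔱}

theorem torusPairs_mem_cartan : ∀ p ∈ torusPairs b, p.1 ∈ 𝔱 ∧ p.2 ∈ 𝔱 := by
  rintro p ⟨k, rfl | rfl | rfl | rfl⟩
  · exact ⟨(b (k, 0)).2, (b (k, 1)).2⟩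
  · exact ⟨(b (k, 1)).2, 𝔱.neg_mem (b (k, 0)).2⟩
  · exact ⟨𝔱.neg_mem (b (k, 0)).2, 𝔱.neg_mem (b (k, 1)).2⟩
  · exact ⟨𝔱.neg_mem (b (k, 1)).2, (b (k, 0)).2⟩

/-- Closure holds because `torusPairs` lists all four multiples of each basis pair by powers of -i.
-/
theorem torusPairs_rotate : ∀ p ∈ torusPairs b, (p.2, -p.1) ∈ torusPairs b := by
  rintro p ⟨k, rfl | rfl | rfl | rfl⟩ <;> refine ⟨k, ?_⟩ <;> simp

theorem torusPairs_inner_eq (hb : ∀ p q, κ (b p : L) (b q : L) = if p = q then 1 else 0) :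
    ∀ p ∈ torusPairs b, ∀ q ∈ torusPairs b, κ p.1 q.1 = κ p.2 q.2 := by
  rintro p ⟨k, rfl | rfl | rfl | rfl⟩ q ⟨l, rfl | rfl | rfl | rfl⟩ <;> simp [hb]

theorem cartan_le_map_fst_torusPairs : ∀ t ∈ 𝔱,
    t ∈ (samelsonGraph P (torusPairs b)).map (LinearMap.fst ℝ L L) := by
  intro t ht
  have h1 := b.mem_span ⟨t, ht⟩
  have h2 : Submodule.span ℝ (Set.range b) ≤
      ((samelsonGraph P (torusPairs b)).map (LinearMap.fst ℝ L L)).comap 𝔱.toSubmodule.subtype := by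
    rw [Submodule.span_le]
    rintro _ ⟨⟨k, i⟩, rfl⟩
    fin_cases i
    · exact ⟨_, Submodule.subset_span (Or.inr ⟨k, Or.inl rfl⟩), rfl⟩
    · exact ⟨_, Submodule.subset_span (Or.inr ⟨k, Or.inr (Or.inl rfl)⟩), rfl⟩
  exact h2 h1

theorem IsSamelson.eq_of_mem_graph {J : L →ₗ[ℝ] L} (hJ : IsSamelson P b J) {p : L × L}
    (hp : p ∈ samelsonGraph P (torusPairs b)) : J p.1 = p.2 := by
  induction hp using Submodule.span_induction with
  | mem p hp =>
    rcases hp with ⟨α, hα, hp⟩ | ⟨k, rfl | rfl | rfl | rfl⟩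
    · exact hJ.root α hα _ _ hp
    · exact hJ.fst k
    · exact hJ.snd k
    · simp [hJ.fst k]
    · simp [hJ.snd k]
  | zero => simp
  | add p q _ _ hp hq => simp [hp, hq]
  | smul c p _ hp => simp [hp]

variable [FiniteDimensional ℝ L]

theorem samelsonGraph_map_fst_eq_top (h : IsInvariantInner κ) (h𝔱 : 𝔱.IsCartanSubalgebra)
    (hP : IsPositiveRootSet 𝔱 P) (T : Set (L × L))
    (hT : ∀ t ∈ 𝔱, t ∈ (samelsonGraph P T).map (LinearMap.fst ℝ L L)) :
    (samelsonGraph P T).map (LinearMap.fst ℝ L L) = ⊤ := by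
  rw [eq_top_iff]
  intro X _
  refine (sup_le (fun t ht => hT t ht) ?_ : 𝔱.toSubmodule ⊔ Submodule.span ℝ
    {X | ∃ α ≠ 0, ∃ Y, IsRootPair 𝔱 α X Y} ≤ _) (h.mem_sup_span_rootPairs h𝔱 X)
  rw [Submodule.span_le]
  rintro X ⟨α, hα, Y, hp⟩
  exact rootPair_mem_map_fst hP T hα hp

/-- With no torus pairs, the graph projects isomorphically onto a complement of 𝔱. Rotation is a
complex structure on it, so this complement is even-dimensional. -/
theorem even_finrank_cartan (h : IsInvariantInner κ) (h𝔱 : 𝔱.IsCartanSubalgebra)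
    (hL : Even (Module.finrank ℝ L)) : Even (Module.finrank ℝ 𝔱) := by
  obtain ⟨P, hP⟩ := exists_isPositiveRootSet 𝔱
  have hab : ∀ x ∈ 𝔱, ∀ y ∈ 𝔱, ⁅x, y⁆ = 0 := fun x hx y hy => h.cartan_lie_eq_zero h𝔱 hx hy
  set Γ := samelsonGraph P (∅ : Set (L × L)) with hΓ
  have hrot : ∀ p ∈ Γ, (p.2, -p.1) ∈ Γ := fun p hp => samelsonGraph_rotate (by simp) hp
  have hiso : ∀ p ∈ Γ, ∀ q ∈ Γ, κ p.1 q.1 = κ p.2 q.2 := fun p hp q hq =>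
    samelsonGraph_inner_eq h hab hP (by simp) (by simp) hp hq
  let R : Γ →ₗ[ℝ] Γ :=
    { toFun := fun p => ⟨(p.1.2, -p.1.1), hrot p p.2⟩
      map_add' := fun p q => Subtype.ext (by ext <;> simp [add_comm])
      map_smul' := fun c p => Subtype.ext (by ext <;> simp) }
  have hR : ∀ p, R (R p) = -p := fun p => Subtype.ext rfl
  have hΓeven := even_finrank_of_sq_eq_neg_one R hR
  -- Isotropy gives `κ Y Y = κ 0 0 = 0` for a pair `(0, Y)`, hence `Y = 0`.
  have hinj : Function.Injective ((LinearMap.fst ℝ L L).domRestrict Γ) := by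
    rw [injective_iff_map_eq_zero]
    intro p hp
    have h1 : p.1.1 = 0 := hp
    have h2 := hiso p p.2 p p.2
    rw [h1, map_zero] at h2
    exact Subtype.ext (Prod.ext h1 (h.eq_zero h2.symm))
  have hrange : LinearMap.range ((LinearMap.fst ℝ L L).domRestrict Γ)
      = Γ.map (LinearMap.fst ℝ L L) := LinearMap.range_domRestrict _ _
  have hrank := LinearMap.finrank_range_of_inj hinj
  rw [hrange] at hrank
  have horth : ∀ t ∈ 𝔱, ∀ p ∈ Γ, κ t p.1 = 0 := by
    intro t ht p hp
    induction hp using Submodule.span_induction with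
    | mem p hp =>
      rcases hp with ⟨α, hα, hp⟩ | hp
      · exact hp.inner_cartan h hab (hP.subset hα).1 ht
      · exact hp.elim
    | zero => simp
    | add p q _ _ hp hq => simp_all
    | smul c p _ hp => simp_all
  have hcompl : IsCompl 𝔱.toSubmodule (Γ.map (LinearMap.fst ℝ L L)) := by
    constructor
    · rw [Submodule.disjoint_def]
      rintro t ht ⟨p, hp, hpt⟩
      have h1 := horth t ht p hp
      rw [show p.1 = t from hpt] at h1
      exact h.eq_zero h1
    · rw [codisjoint_iff, eq_top_iff]
      intro X _
      refine (sup_le le_sup_left ?_ : 𝔱.toSubmodule ⊔ Submodule.span ℝ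
        {X | ∃ α ≠ 0, ∃ Y, IsRootPair 𝔱 α X Y} ≤ _) (h.mem_sup_span_rootPairs h𝔱 X)
      rw [Submodule.span_le]
      rintro X ⟨α, hα, Y, hp⟩
      exact Submodule.mem_sup_right (rootPair_mem_map_fst hP ∅ hα hp)
  have hsum := Submodule.finrank_add_eq_of_isCompl hcompl
  rw [hrank] at hsum
  rw [← hsum, Nat.even_add] at hL
  exact hL.2 hΓeven

theorem exists_orthonormal_pairs_cartan (h : IsInvariantInner κ) (h𝔱 : 𝔱.IsCartanSubalgebra)
    (hL : Even (Module.finrank ℝ L)) :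
    ∃ (m : ℕ) (b : Module.Basis (Fin m × Fin 2) ℝ 𝔱),
      ∀ p q, κ (b p : L) (b q : L) = if p = q then 1 else 0 := by
  obtain ⟨m, hm⟩ := even_finrank_cartan h h𝔱 hL
  obtain ⟨b, hb⟩ := exists_orthonormal_basis_of_posDef (ι := Fin m × Fin 2)
    (κ.restrict 𝔱.toSubmodule) (fun x y => h.symm x y)
    (fun x hx => h.pos x fun h0 => hx (Subtype.ext h0))
    (by rw [Fintype.card_prod, Fintype.card_fin, Fintype.card_fin, mul_two]; exact hm.symm)
  exact ⟨m, b, hb⟩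

variable (h : IsInvariantInner κ) (h𝔱 : 𝔱.IsCartanSubalgebra) (hP : IsPositiveRootSet 𝔱 P)
include h h𝔱 hP

/-- The graph of `J` contains `samelsonGraph`, and the latter already projects onto everything; so
the two agree and closure properties of the span become properties of `J`. -/
theorem IsSamelson.mem_graph {J : L →ₗ[ℝ] L} (hJ : IsSamelson P b J) (X : L) :
    (X, J X) ∈ samelsonGraph P (torusPairs b) := by
  have h1 : X ∈ (samelsonGraph P (torusPairs b)).map (LinearMap.fst ℝ L L) := by
    rw [samelsonGraph_map_fst_eq_top h h𝔱 hP _ cartan_le_map_fst_torusPairs]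
    trivial
  obtain ⟨p, hp, rfl⟩ := h1
  rw [LinearMap.fst_apply, hJ.eq_of_mem_graph hp]
  exact hp

theorem IsSamelson.unique {J J' : L →ₗ[ℝ] L} (hJ : IsSamelson P b J) (hJ' : IsSamelson P b J') :
    J = J' :=
  LinearMap.ext fun X => (hJ'.eq_of_mem_graph (hJ.mem_graph h h𝔱 hP X)).symm

theorem IsSamelson.sq {J : L →ₗ[ℝ] L} (hJ : IsSamelson P b J) (X : L) : J (J X) = -X :=
  hJ.eq_of_mem_graph (samelsonGraph_rotate torusPairs_rotate (hJ.mem_graph h h𝔱 hP X))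

theorem IsSamelson.inner_map {J : L →ₗ[ℝ] L} (hJ : IsSamelson P b J)
    (hb : ∀ p q, κ (b p : L) (b q : L) = if p = q then 1 else 0) (X Y : L) :
    κ (J X) (J Y) = κ X Y :=
  (samelsonGraph_inner_eq h (fun _ hx _ hy => h.cartan_lie_eq_zero h𝔱 hx hy) hP
    torusPairs_mem_cartan (torusPairs_inner_eq hb) (hJ.mem_graph h h𝔱 hP X)
    (hJ.mem_graph h h𝔱 hP Y)).symm

/-- Closure under the bracket says `J (⁅X, Y⁆ - ⁅J X, J Y⁆) = ⁅X, J Y⁆ + ⁅J X, Y⁆`; apply `J` once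
more. -/
theorem IsSamelson.nijenhuis {J : L →ₗ[ℝ] L} (hJ : IsSamelson P b J) (X Y : L) :
    ⁅X, Y⁆ + J ⁅J X, Y⁆ + J ⁅X, J Y⁆ - ⁅J X, J Y⁆ = 0 := by
  have h1 := hJ.eq_of_mem_graph (samelsonGraph_lie
    (fun _ hx _ hy => h.cartan_lie_eq_zero h𝔱 hx hy) hP torusPairs_mem_cartan
    (hJ.mem_graph h h𝔱 hP X) (hJ.mem_graph h h𝔱 hP Y))
  have h2 := congrArg J h1
  rw [hJ.sq h h𝔱 hP, map_add] at h2
  simp only at h2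
  rw [add_assoc, add_comm (J ⁅J X, Y⁆), ← h2]
  abel

/-- Isotropy makes the first projection of the graph injective and the root decomposition makes it
onto, so the span is the graph of a linear map. -/
theorem exists_isSamelson (hb : ∀ p q, κ (b p : L) (b q : L) = if p = q then 1 else 0) :
    ∃ J : L →ₗ[ℝ] L, IsSamelson P b J := by
  set Γ := samelsonGraph P (torusPairs b) with hΓ
  have hiso : ∀ p ∈ Γ, ∀ q ∈ Γ, κ p.1 q.1 = κ p.2 q.2 := fun p hp q hq =>
    samelsonGraph_inner_eq h (fun _ hx _ hy => h.cartan_lie_eq_zero h𝔱 hx hy) hP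
      torusPairs_mem_cartan (torusPairs_inner_eq hb) hp hq
  have hinj : Function.Injective ((LinearMap.fst ℝ L L).domRestrict Γ) := by
    rw [injective_iff_map_eq_zero]
    intro p hp
    have h1 : p.1.1 = 0 := hp
    have h2 := hiso p p.2 p p.2
    rw [h1, map_zero] at h2
    exact Subtype.ext (Prod.ext h1 (h.eq_zero h2.symm))
  have hsurj : Function.Surjective ((LinearMap.fst ℝ L L).domRestrict Γ) := by
    rw [← LinearMap.range_eq_top, LinearMap.range_domRestrict]
    exact samelsonGraph_map_fst_eq_top h h𝔱 hP _ cartan_le_map_fst_torusPairs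
  let e := LinearEquiv.ofBijective _ ⟨hinj, hsurj⟩
  let J : L →ₗ[ℝ] L := (LinearMap.snd ℝ L L).domRestrict Γ ∘ₗ e.symm.toLinearMap
  have hJ : ∀ p ∈ Γ, J p.1 = p.2 := by
    intro p hp
    have h1 : e.symm p.1 = ⟨p, hp⟩ := by
      rw [LinearEquiv.symm_apply_eq]
      rfl
    change ((e.symm p.1 : Γ) : L × L).2 = p.2
    rw [h1]
  exact ⟨J, fun α hα X Y hp => hJ (X, Y) (Submodule.subset_span (Or.inl ⟨α, hα, hp⟩)),
    fun k => hJ (_, _) (Submodule.subset_span (Or.inr ⟨k, Or.inl rfl⟩)),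
    fun k => hJ (_, _) (Submodule.subset_span (Or.inr ⟨k, Or.inr (Or.inl rfl)⟩))⟩

end SamelsonStructure

end Samelson

namespace Samelson

/-! ### Smoothness of bundle maps tested on a frame. -/

section Frame

variable {EB : Type*} [NormedAddCommGroup EB] [NormedSpace ℝ EB]
  {HB : Type*} [TopologicalSpace HB] {IB : ModelWithCorners ℝ EB HB} {n : WithTop ℕ∞}
  {B : Type*} [TopologicalSpace B] [ChartedSpace HB B]

/-- A family of continuous linear maps on a finite-dimensional space is smooth if it is
pointwise smooth. -/
theorem contMDiffAt_clm_of_apply {W F : Type*} [NormedAddCommGroup W] [NormedSpace ℝ W]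
    [FiniteDimensional ℝ W] [NormedAddCommGroup F] [NormedSpace ℝ F] {f : B → W →L[ℝ] F} {x₀ : B}
    (hf : ∀ w, ContMDiffAt IB 𝓘(ℝ, F) n (fun x => f x w) x₀) :
    ContMDiffAt IB 𝓘(ℝ, W →L[ℝ] F) n f x₀ := by
  let b := Module.finBasis ℝ W
  let c : Fin (Module.finrank ℝ W) → (W →L[ℝ] ℝ) := fun i => (b.coord i).toContinuousLinearMap
  -- In a basis, `f x` is the sum of the coordinate forms times the smooth vectors `f x (b i)`.
  have h1 : f = fun x => ∑ i, ContinuousLinearMap.smulRightL ℝ W F (c i) (f x (b i)) := by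
    ext x w
    nth_rw 1 [← b.sum_repr w]
    simp only [map_sum, map_smul]
    simp [c]
  rw [h1]
  refine ContMDiffAt.sum fun i _ => ?_
  exact (ContinuousLinearMap.contMDiff _).contMDiffAt.comp x₀ (hf (b i))

variable {F₁ : Type*} [NormedAddCommGroup F₁] [NormedSpace ℝ F₁] {E₁ : B → Type*}
  [TopologicalSpace (TotalSpace F₁ E₁)] [∀ x, AddCommGroup (E₁ x)] [∀ x, Module ℝ (E₁ x)]
  [∀ x, TopologicalSpace (E₁ x)] [FiberBundle F₁ E₁] [VectorBundle ℝ F₁ E₁]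
  {F₂ : Type*} [NormedAddCommGroup F₂] [NormedSpace ℝ F₂] {E₂ : B → Type*}
  [TopologicalSpace (TotalSpace F₂ E₂)] [∀ x, AddCommGroup (E₂ x)] [∀ x, Module ℝ (E₂ x)]
  [∀ x, TopologicalSpace (E₂ x)] [FiberBundle F₂ E₂] [VectorBundle ℝ F₂ E₂]
  [∀ x, IsTopologicalAddGroup (E₂ x)] [∀ x, ContinuousSMul ℝ (E₂ x)]
  {W : Type*} [NormedAddCommGroup W] [NormedSpace ℝ W] [FiniteDimensional ℝ W]

/-- A section of a bundle of linear maps is smooth if it maps a smooth frame to smooth sections. -/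
theorem contMDiffAt_hom_of_frame {x₀ : B} (S : ∀ x, W ≃L[ℝ] E₁ x) (φ : ∀ x, E₁ x →L[ℝ] E₂ x)
    (hS : ∀ w, ContMDiffAt IB (IB.prod 𝓘(ℝ, F₁)) n (fun x => TotalSpace.mk' F₁ x (S x w)) x₀)
    (hφ : ∀ w, ContMDiffAt IB (IB.prod 𝓘(ℝ, F₂)) n
      (fun x => TotalSpace.mk' F₂ x (φ x (S x w))) x₀) :
    ContMDiffAt IB (IB.prod 𝓘(ℝ, F₁ →L[ℝ] F₂)) n
      (fun x => TotalSpace.mk' (F₁ →L[ℝ] F₂) (E := fun x => E₁ x →L[ℝ] E₂ x) x (φ x)) x₀ := by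
  have : FiniteDimensional ℝ F₁ := Module.Finite.equiv
    ((S x₀).toLinearEquiv.trans (VectorBundle.continuousLinearEquivAt ℝ F₁ E₁ x₀).toLinearEquiv)
  have : CompleteSpace W := FiniteDimensional.complete ℝ W
  set e₁ := trivializationAt F₁ E₁ x₀ with he₁
  set e₂ := trivializationAt F₂ E₂ x₀ with he₂
  have hb₁ : x₀ ∈ e₁.baseSet := FiberBundle.mem_baseSet_trivializationAt F₁ E₁ x₀
  have hb₂ : x₀ ∈ e₂.baseSet := FiberBundle.mem_baseSet_trivializationAt F₂ E₂ x₀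
  let s : B → W →L[ℝ] F₁ := fun x => (e₁.continuousLinearMapAt ℝ x) ∘L (S x : W →L[ℝ] E₁ x)
  let t : B → W →L[ℝ] F₂ := fun x =>
    (e₂.continuousLinearMapAt ℝ x) ∘L (φ x ∘L (S x : W →L[ℝ] E₁ x))
  have hev : ∀ᶠ x in nhds x₀, x ∈ e₁.baseSet ∧ x ∈ e₂.baseSet :=
    (e₁.open_baseSet.inter e₂.open_baseSet).mem_nhds ⟨hb₁, hb₂⟩
  have hs : ContMDiffAt IB 𝓘(ℝ, W →L[ℝ] F₁) n s x₀ := by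
    refine contMDiffAt_clm_of_apply fun w => ?_
    have h1 := contMDiffAt_section _ |>.1 (hS w)
    refine h1.congr_of_eventuallyEq ?_
    filter_upwards [hev] with x hx
    exact congrFun (Trivialization.coe_linearMapAt_of_mem (R := ℝ) e₁ hx.1) _
  have ht : ContMDiffAt IB 𝓘(ℝ, W →L[ℝ] F₂) n t x₀ := by
    refine contMDiffAt_clm_of_apply fun w => ?_
    have h1 := contMDiffAt_section _ |>.1 (hφ w)
    refine h1.congr_of_eventuallyEq ?_
    filter_upwards [hev] with x hx
    exact congrFun (Trivialization.coe_linearMapAt_of_mem (R := ℝ) e₂ hx.2) _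
  let σ : ∀ x, x ∈ e₁.baseSet → (W ≃L[ℝ] F₁) := fun x hx =>
    (S x).trans (e₁.continuousLinearEquivAt ℝ x hx)
  have hσ : ∀ x (hx : x ∈ e₁.baseSet), s x = (σ x hx : W →L[ℝ] F₁) := by
    intro x hx
    ext w
    simp [s, σ, Trivialization.coe_linearMapAt_of_mem (R := ℝ) e₁ hx]
  have hinv : ContMDiffAt IB 𝓘(ℝ, F₁ →L[ℝ] W) n (fun x => (s x).inverse) x₀ := by
    have h1 : ContDiffAt ℝ n ContinuousLinearMap.inverse (s x₀) := by
      rw [hσ x₀ hb₁]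
      exact contDiffAt_map_inverse _
    exact h1.contMDiffAt.comp x₀ hs
  rw [contMDiffAt_hom_bundle]
  refine ⟨contMDiffAt_id, ?_⟩
  refine (ht.clm_comp hinv).congr_of_eventuallyEq ?_
  filter_upwards [hev] with x hx
  rw [ContinuousLinearMap.inCoordinates_eq hx.1 hx.2, hσ x hx.1, ContinuousLinearMap.inverse_equiv]
  ext v
  simp [t, σ, Trivialization.coe_linearMapAt_of_mem (R := ℝ) e₂ hx.2]
  rfl

end Frame

end Samelson

/-! ### Left translations and left-invariant vector fields. -/

namespace Samelson

/-- The hypothesis `a = 1` and the ascription to `Model d` avoid transport between the tangent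
spaces at `a * x` and `x`. -/
theorem mfderiv_one_mul {d : ℕ} {G : Type*} [TopologicalSpace G] [ChartedSpace (Model d) G]
    [Group G] (x : G) (v : TangentSpace (𝓡 d) x) {a : G} (ha : a = 1) :
    (mfderiv (𝓡 d) (𝓡 d) (fun z : G => a * z) x v : Model d) = v := by
  subst ha
  have h1 : (fun z : G => 1 * z) = id := by ext z; simp
  rw [h1, mfderiv_id]
  rfl

section LeftTranslation

variable {d : ℕ} {G : Type*} [TopologicalSpace G] [ChartedSpace (Model d) G] [Group G]
  [LieGroup (𝓡 d) ∞ G]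

theorem mdifferentiableAt_mul_left (a x : G) :
    MDifferentiableAt (𝓡 d) (𝓡 d) (fun y : G => a * y) x :=
  (contMDiff_mul_left (I := 𝓡 d) (n := ∞)).contMDiffAt.mdifferentiableAt (by simp)

theorem mfderiv_mul_left_mul_left (a b : G) {x y : G} (h : b * x = y)
    (v : TangentSpace (𝓡 d) x) :
    (mfderiv (𝓡 d) (𝓡 d) (fun z : G => a * z) y
      (mfderiv (𝓡 d) (𝓡 d) (fun z : G => b * z) x v : Model d) : Model d)
      = mfderiv (𝓡 d) (𝓡 d) (fun z : G => a * b * z) x v := by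
  subst h
  have h1 : (fun z : G => a * b * z) = (fun z => a * z) ∘ fun z => b * z := by
    ext z; simp [mul_assoc]
  rw [h1, mfderiv_comp (I' := 𝓡 d) x (mdifferentiableAt_mul_left a _)
    (mdifferentiableAt_mul_left b x)]
  rfl

/-- The derivative of the left translation by `x`, from the Lie algebra to the tangent space
at `x`. -/
noncomputable def leftFrame (x : G) : Model d ≃L[ℝ] TangentSpace (𝓡 d) x :=
  ContinuousLinearEquiv.equivOfInverse
    (mfderiv (𝓡 d) (𝓡 d) (fun y : G => x * y) 1 : Model d →L[ℝ] Model d)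
    (mfderiv (𝓡 d) (𝓡 d) (fun y : G => x⁻¹ * y) x : Model d →L[ℝ] Model d)
    (fun v => by
      refine (mfderiv_mul_left_mul_left (d := d) x⁻¹ x (mul_one x) v).trans ?_
      exact mfderiv_one_mul 1 v (inv_mul_cancel x))
    (fun v => by
      refine (mfderiv_mul_left_mul_left (d := d) x x⁻¹ (inv_mul_cancel x) v).trans ?_
      exact mfderiv_one_mul x v (mul_inv_cancel x))

theorem maurerCartan_mulInvariantVectorField (v : Alg d G) (x : G) :
    maurerCartan x (mulInvariantVectorField v x) = v :=
  (leftFrame x).symm_apply_apply v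

theorem mulInvariantVectorField_maurerCartan (x : G) (u : TangentSpace (𝓡 d) x) :
    mulInvariantVectorField (maurerCartan x u) x = u :=
  (leftFrame x).apply_symm_apply u

theorem maurerCartan_mfderiv_mul_left (a x : G) (v : TangentSpace (𝓡 d) x) :
    maurerCartan (a * x) (mfderiv (𝓡 d) (𝓡 d) (fun y : G => a * y) x v) = maurerCartan x v := by
  refine (mfderiv_mul_left_mul_left (d := d) (a * x)⁻¹ a rfl v).trans ?_
  have h1 : (a * x)⁻¹ * a = x⁻¹ := by group
  rw [h1]
  rfl

omit [LieGroup (𝓡 d) ∞ G] in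
theorem maurerCartan_one (v : Alg d G) : maurerCartan (1 : G) v = v :=
  mfderiv_one_mul (1 : G) v inv_one

omit [LieGroup (𝓡 d) ∞ G] in
theorem mulInvariantVectorField_one (v : Alg d G) : mulInvariantVectorField v (1 : G) = v :=
  mfderiv_one_mul (1 : G) v rfl

omit [Group G] [LieGroup (𝓡 d) ∞ G] in
theorem tangentBundle_mk_congr {x y : G} (h : x = y) (u : Model d) :
    (⟨x, u⟩ : TangentBundle (𝓡 d) G) = ⟨y, u⟩ := by
  subst h; rfl

/-- The value at `x` is the derivative of multiplication at (x, 1) applied to (0, v), so the field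
is a composite of smooth maps. -/
theorem contMDiff_mulInvariantVectorField_infty (v : Alg d G) :
    ContMDiff (𝓡 d) (𝓡 d).tangent ∞
      (fun x : G => (⟨x, mulInvariantVectorField v x⟩ : TangentBundle (𝓡 d) G)) := by
  let fg : G → TangentBundle (𝓡 d) G := fun g => TotalSpace.mk' (Model d) g 0
  have sfg : ContMDiff (𝓡 d) (𝓡 d).tangent ∞ fg := contMDiff_zeroSection _ _
  let fv : G → TangentBundle (𝓡 d) G := fun _ => TotalSpace.mk' (Model d) 1 v
  have sfv : ContMDiff (𝓡 d) (𝓡 d).tangent ∞ fv := contMDiff_const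
  let F₁ : G → (TangentBundle (𝓡 d) G × TangentBundle (𝓡 d) G) := fun g => (fg g, fv g)
  have S₁ : ContMDiff (𝓡 d) ((𝓡 d).tangent.prod (𝓡 d).tangent) ∞ F₁ := sfg.prodMk sfv
  let F₂ : (TangentBundle (𝓡 d) G × TangentBundle (𝓡 d) G) →
      TangentBundle ((𝓡 d).prod (𝓡 d)) (G × G) := (equivTangentBundleProd (𝓡 d) G (𝓡 d) G).symm
  have S₂ : ContMDiff ((𝓡 d).tangent.prod (𝓡 d).tangent) ((𝓡 d).prod (𝓡 d)).tangent ∞ F₂ :=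
    contMDiff_equivTangentBundleProd_symm
  let F₃ : TangentBundle ((𝓡 d).prod (𝓡 d)) (G × G) → TangentBundle (𝓡 d) G :=
    tangentMap ((𝓡 d).prod (𝓡 d)) (𝓡 d) (fun (p : G × G) => p.1 * p.2)
  have S₃ : ContMDiff ((𝓡 d).prod (𝓡 d)).tangent (𝓡 d).tangent ∞ F₃ := by
    apply ContMDiff.contMDiff_tangentMap _ (m := ∞) le_rfl
    exact contMDiff_mul (𝓡 d) ∞
  have S := (S₃.comp S₂).comp S₁
  have hS : (fun x : G => (⟨x, mulInvariantVectorField v x⟩ : TangentBundle (𝓡 d) G))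
      = (F₃ ∘ F₂) ∘ F₁ := by
    funext g
    have h1 := mfderiv_prod_eq_add_apply (I := 𝓡 d) (I' := 𝓡 d) (I'' := 𝓡 d)
      (f := fun (p : G × G) => p.1 * p.2) (p := (g, (1 : G)))
      (v := ((0 : TangentSpace (𝓡 d) g), (v : TangentSpace (𝓡 d) (1 : G))))
      ((contMDiff_mul (𝓡 d) ∞).mdifferentiableAt (by simp))
    have h2 : ((F₃ ∘ F₂) ∘ F₁) g = ⟨g * 1, mfderiv ((𝓡 d).prod (𝓡 d)) (𝓡 d)
        (fun (p : G × G) => p.1 * p.2) (g, (1 : G))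
        ((0 : TangentSpace (𝓡 d) g), (v : TangentSpace (𝓡 d) (1 : G)))⟩ := rfl
    rw [h2, h1, map_zero, zero_add]
    exact tangentBundle_mk_congr (mul_one g).symm _
  rw [hS]
  exact S

end LeftTranslation

end Samelson

namespace Samelson

/-! ### The Lie bracket as a commutator of derivations. -/

section Derivation

variable {d : ℕ} {M : Type*} [TopologicalSpace M] [ChartedSpace (Model d) M]
  [IsManifold (𝓡 d) ∞ M] {F : Type*} [NormedAddCommGroup F] [NormedSpace ℝ F]

/-- The second-derivative terms of `f` cancel by symmetry. -/
theorem fderiv_lieBracket {E : Type*} [NormedAddCommGroup E] [NormedSpace ℝ E] {f : E → F}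
    {V W : E → E} {z : E} (hf : ContDiffAt ℝ 2 f z) (hV : DifferentiableAt ℝ V z)
    (hW : DifferentiableAt ℝ W z) :
    fderiv ℝ f z (lieBracket ℝ V W z) = fderiv ℝ (fun y => fderiv ℝ f y (W y)) z (V z)
      - fderiv ℝ (fun y => fderiv ℝ f y (V y)) z (W z) := by
  have h1 : DifferentiableAt ℝ (fderiv ℝ f) z :=
    (hf.fderiv_right (m := 1) (by norm_num)).differentiableAt (by simp)
  have hsymm : fderiv ℝ (fderiv ℝ f) z (V z) (W z) = fderiv ℝ (fderiv ℝ f) z (W z) (V z) :=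
    (hf.isSymmSndFDerivAt (by simp)) _ _
  rw [fderiv_clm_apply h1 hW, fderiv_clm_apply h1 hV, lieBracket]
  simp only [_root_.add_apply, ContinuousLinearMap.comp_apply,
    ContinuousLinearMap.flip_apply, map_sub, hsymm]
  abel

/-- The derivative of a vector-valued function `f` at `x` in the direction `u`. -/
noncomputable def dirDeriv (f : M → F) (x : M) (u : TangentSpace (𝓡 d) x) : F :=
  mfderiv (𝓡 d) 𝓘(ℝ, F) f x u

/-- Pullback by `ψ` commutes with brackets and turns derivatives of `f` into derivatives of `f ∘ ψ`,
which reduces the claim to the vector-space formula. -/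
theorem dirDeriv_mlieBracket_of_chart {ψ : Model d → M} {U : Set (Model d)} (hU : IsOpen U)
    (hψ : ContMDiffOn 𝓘(ℝ, Model d) (𝓡 d) ∞ ψ U)
    (hinv : ∀ z ∈ U, (mfderiv 𝓘(ℝ, Model d) (𝓡 d) ψ z).IsInvertible) {z : Model d} (hz : z ∈ U)
    {f : M → F} (hf : ContMDiff (𝓡 d) 𝓘(ℝ, F) ∞ f) {V W : (x : M) → TangentSpace (𝓡 d) x}
    (hV : DiffField V (ψ z)) (hW : DiffField W (ψ z))
    (hfV : MDifferentiableAt (𝓡 d) 𝓘(ℝ, F)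
      (fun y => dirDeriv f y (V y)) (ψ z))
    (hfW : MDifferentiableAt (𝓡 d) 𝓘(ℝ, F)
      (fun y => dirDeriv f y (W y)) (ψ z)) :
    dirDeriv f (ψ z) (mlieBracket (𝓡 d) V W (ψ z))
      = dirDeriv (fun y => dirDeriv f y (W y)) (ψ z) (V (ψ z))
        - dirDeriv (fun y => dirDeriv f y (V y)) (ψ z) (W (ψ z)) := by
  have hM2 : IsManifold (𝓡 d) 2 M := IsManifold.of_le (n := ∞) (by norm_cast)
  have hM3 : IsManifold (𝓡 d) (minSmoothness ℝ 3) M :=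
    IsManifold.of_le (n := ∞) (by simp; norm_cast)
  have hψat : ∀ y ∈ U, ContMDiffAt 𝓘(ℝ, Model d) (𝓡 d) ∞ ψ y := fun y hy =>
    hψ.contMDiffAt (hU.mem_nhds hy)
  have hψd : ∀ y ∈ U, MDifferentiableAt 𝓘(ℝ, Model d) (𝓡 d) ψ y := fun y hy =>
    (hψat y hy).mdifferentiableAt (by simp)
  let pull : ((x : M) → TangentSpace (𝓡 d) x) → Model d → Model d := fun X y =>
    mpullback 𝓘(ℝ, Model d) (𝓡 d) ψ X y
  have hpush : ∀ (X : (x : M) → TangentSpace (𝓡 d) x), ∀ y ∈ U,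
      mfderiv 𝓘(ℝ, Model d) (𝓡 d) ψ y (pull X y) = X (ψ y) := by
    intro X y hy
    exact (hinv y hy).self_apply_inverse (X (ψ y))
  have hdiff : ∀ X : (x : M) → TangentSpace (𝓡 d) x, DiffField X (ψ z) →
      DifferentiableAt ℝ (pull X) z := by
    intro X hX
    have h1 := MDifferentiableAt.mpullback_vectorField hX (hψat z hz) (hinv z hz)
      (by norm_cast)
    have h2 := ((contMDiff_snd_tangentBundle_modelSpace (Model d) 𝓘(ℝ, Model d)
      (n := 1)).contMDiffAt.mdifferentiableAt one_ne_zero).comp z h1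
    exact h2.differentiableAt
  have hcomp : ∀ {g : M → F}, ∀ y ∈ U, MDifferentiableAt (𝓡 d) 𝓘(ℝ, F) g (ψ y) →
      ∀ X : (x : M) → TangentSpace (𝓡 d) x,
      fderiv ℝ (g ∘ ψ) y (pull X y) = dirDeriv g (ψ y) (X (ψ y)) := by
    intro g y hy hg X
    rw [← mfderiv_eq_fderiv, mfderiv_comp (I' := 𝓡 d) y hg (hψd y hy), ← hpush X y hy]
    rfl
  have hev : ∀ X : (x : M) → TangentSpace (𝓡 d) x,
      (fun y => fderiv ℝ (f ∘ ψ) y (pull X y)) =ᶠ[nhds z]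
        (fun y => dirDeriv f y (X y)) ∘ ψ := by
    intro X
    filter_upwards [hU.mem_nhds hz] with y hy
    exact hcomp y hy (hf.mdifferentiableAt (by simp)) X
  have hFz : ContDiffAt ℝ 2 (f ∘ ψ) z :=
    ((hf.contMDiffAt.comp z (hψat z hz)).contDiffAt).of_le (by norm_cast)
  have hbr : pull (mlieBracket (𝓡 d) V W) z = lieBracket ℝ (pull V) (pull W) z := by
    have h1 := mpullback_mlieBracket (n := ∞) hV hW (hψat z hz) (by simp; norm_cast)
    refine h1.trans ?_
    rw [← mlieBracketWithin_univ, mlieBracketWithin_eq_lieBracketWithin]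
    exact congrFun (lieBracketWithin_univ (𝕜 := ℝ) (V := pull V) (W := pull W)) z
  have main := fderiv_lieBracket hFz (hdiff V hV) (hdiff W hW)
  rw [← hbr, hcomp z hz (hf.mdifferentiableAt (by simp)), (hev W).fderiv_eq, (hev V).fderiv_eq,
    hcomp z hz hfW, hcomp z hz hfV] at main
  exact main

/-- The Lie bracket of vector fields is the commutator of the corresponding derivations. -/
theorem dirDeriv_mlieBracket {x : M} {f : M → F} (hf : ContMDiff (𝓡 d) 𝓘(ℝ, F) ∞ f)
    {V W : (x : M) → TangentSpace (𝓡 d) x} (hV : DiffField V x) (hW : DiffField W x)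
    (hfV : MDifferentiableAt (𝓡 d) 𝓘(ℝ, F) (fun y => dirDeriv f y (V y)) x)
    (hfW : MDifferentiableAt (𝓡 d) 𝓘(ℝ, F) (fun y => dirDeriv f y (W y)) x) :
    dirDeriv f x (mlieBracket (𝓡 d) V W x)
      = dirDeriv (fun y => dirDeriv f y (W y)) x (V x)
        - dirDeriv (fun y => dirDeriv f y (V y)) x (W x) := by
  have hM1 : IsManifold (𝓡 d) 1 M := IsManifold.of_le (n := ∞) (by norm_cast)
  obtain ⟨z, hz, hzx⟩ : ∃ z ∈ (extChartAt (𝓡 d) x).target, (extChartAt (𝓡 d) x).symm z = x :=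
    ⟨_, mem_extChartAt_target x, extChartAt_to_inv x⟩
  have key := dirDeriv_mlieBracket_of_chart (ψ := (extChartAt (𝓡 d) x).symm)
    (isOpen_extChartAt_target x) (contMDiffOn_extChartAt_symm x)
    (fun y hy => by
      have := isInvertible_mfderivWithin_extChartAt_symm hy
      rwa [ModelWithCorners.range_eq_univ, mfderivWithin_univ] at this) hz hf (V := V) (W := W)
  -- The tangent space depends on the base point, so that point becomes a variable before it is
  -- identified with `x`.
  generalize (extChartAt (𝓡 d) x).symm z = y at key hzx
  subst hzx
  exact key hV hW hfV hfW

end Derivation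

end Samelson

namespace Samelson

/-! ### Rules for directional derivatives. -/

section DirDeriv

variable {d : ℕ} {M : Type*} [TopologicalSpace M] [ChartedSpace (Model d) M]
  {F F' : Type*} [NormedAddCommGroup F] [NormedSpace ℝ F]
  [NormedAddCommGroup F'] [NormedSpace ℝ F']

theorem dirDeriv_add_right (f : M → F) (x : M) (u v : TangentSpace (𝓡 d) x) :
    dirDeriv f x (u + v) = dirDeriv f x u + dirDeriv f x v :=
  map_add (mfderiv (𝓡 d) 𝓘(ℝ, F) f x) u v

theorem dirDeriv_smul_right (f : M → F) (x : M) (c : ℝ) (u : TangentSpace (𝓡 d) x) :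
    dirDeriv f x (c • u) = c • dirDeriv f x u :=
  map_smul (mfderiv (𝓡 d) 𝓘(ℝ, F) f x) c u

theorem dirDeriv_clm_comp (T : F →L[ℝ] F') {f : M → F} {x : M}
    (hf : MDifferentiableAt (𝓡 d) 𝓘(ℝ, F) f x) (u : TangentSpace (𝓡 d) x) :
    dirDeriv (fun y => T (f y)) x u = T (dirDeriv f x u) := by
  have h1 := (T.hasMFDerivAt (x := f x)).comp x hf.hasMFDerivAt
  have h2 : mfderiv (𝓡 d) 𝓘(ℝ, F') (fun y => T (f y)) x
    = T.comp (mfderiv (𝓡 d) 𝓘(ℝ, F) f x) := h1.mfderiv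
  unfold dirDeriv
  rw [h2]
  rfl

theorem dirDeriv_const (c : F) (x : M) (u : TangentSpace (𝓡 d) x) :
    dirDeriv (fun _ : M => c) x u = 0 := by
  unfold dirDeriv
  rw [mfderiv_const]
  rfl

theorem dirDeriv_bilin (T : F →L[ℝ] F →L[ℝ] F') {f g : M → F} {x : M}
    (hf : MDifferentiableAt (𝓡 d) 𝓘(ℝ, F) f x) (hg : MDifferentiableAt (𝓡 d) 𝓘(ℝ, F) g x)
    (u : TangentSpace (𝓡 d) x) :
    dirDeriv (fun y => T (f y) (g y)) x u = T (dirDeriv f x u) (g x) + T (f x) (dirDeriv g x u) := by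
  have h0 : HasFDerivAt (fun p : F × F => T p.1 p.2) (T.deriv₂ (f x, g x)) (f x, g x) :=
    T.isBoundedBilinearMap.hasFDerivAt (f x, g x)
  have hfg : HasMFDerivAt (𝓡 d) 𝓘(ℝ, F × F) (fun y => (f y, g y)) x
      ((mfderiv (𝓡 d) 𝓘(ℝ, F) f x : TangentSpace (𝓡 d) x →L[ℝ] F).prod
        (mfderiv (𝓡 d) 𝓘(ℝ, F) g x : TangentSpace (𝓡 d) x →L[ℝ] F)) :=
    ⟨hf.hasMFDerivAt.1.prodMk hg.hasMFDerivAt.1, hf.hasMFDerivAt.2.prodMk hg.hasMFDerivAt.2⟩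
  have h1 := HasMFDerivAt.comp (g := fun p : F × F => T p.1 p.2) x h0.hasMFDerivAt hfg
  have h2 := h1.mfderiv
  have h3 := congrArg (fun L : TangentSpace (𝓡 d) x →L[ℝ] F' => L u) h2
  refine h3.trans ?_
  refine (add_comm _ _).trans ?_
  rfl

end DirDeriv

end Samelson

namespace Samelson

/-! ### The derivative of the matrix representation. -/

section Representation

variable {d : ℕ} {G : Type*} [TopologicalSpace G] [ChartedSpace (Model d) G] [Group G]
  {N : ℕ}

/-- The matrix-valued function of a representation, in the normed space of arrays. -/
noncomputable def repFun (ρ : G →* Matrix.unitaryGroup (Fin N) ℂ) (x : G) : Fin N → Fin N → ℂ :=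
  Matrix.of.symm (ρ x).1

/-- The derivative at `x` of a matrix representation. -/
noncomputable def repDeriv (ρ : G →* Matrix.unitaryGroup (Fin N) ℂ) (x : G)
    (u : TangentSpace (𝓡 d) x) : Matrix (Fin N) (Fin N) ℂ :=
  Matrix.of (dirDeriv (repFun ρ) x u)

/-- Multiplication of arrays by a matrix on the left. -/
noncomputable def mulLeftCLM (A : Matrix (Fin N) (Fin N) ℂ) :
    (Fin N → Fin N → ℂ) →L[ℝ] (Fin N → Fin N → ℂ) :=
  LinearMap.toContinuousLinearMap ((Matrix.ofLinearEquiv ℝ).symm.toLinearMap ∘ₗ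
    LinearMap.mulLeft ℝ A ∘ₗ (Matrix.ofLinearEquiv ℝ).toLinearMap)

/-- Multiplication of arrays by a matrix on the right. -/
noncomputable def mulRightCLM (A : Matrix (Fin N) (Fin N) ℂ) :
    (Fin N → Fin N → ℂ) →L[ℝ] (Fin N → Fin N → ℂ) :=
  LinearMap.toContinuousLinearMap ((Matrix.ofLinearEquiv ℝ).symm.toLinearMap ∘ₗ
    LinearMap.mulRight ℝ A ∘ₗ (Matrix.ofLinearEquiv ℝ).toLinearMap)

/-- The sesquilinear map `A, B ↦ A Bᴴ` as a real bilinear map. -/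
noncomputable def mulConjTransposeCLM (N : ℕ) :
    (Fin N → Fin N → ℂ) →L[ℝ] (Fin N → Fin N → ℂ) →L[ℝ] (Fin N → Fin N → ℂ) :=
  LinearMap.toContinuousBilinearMap (LinearMap.mk₂ ℝ
    (fun A B => Matrix.of.symm (Matrix.of A * (Matrix.of B).conjTranspose))
    (fun A A' B => congrArg Matrix.of.symm (add_mul (Matrix.of A) (Matrix.of A') _))
    (fun c A B => congrArg Matrix.of.symm (smul_mul_assoc c (Matrix.of A) _))
    (fun A B B' => congrArg Matrix.of.symm (by
      rw [← Matrix.of_add_of, Matrix.conjTranspose_add, mul_add]; rfl))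
    (fun c A B => congrArg Matrix.of.symm (by
      rw [← Matrix.smul_of, Matrix.conjTranspose_smul, star_trivial, mul_smul_comm]; rfl)))

variable {ρ : G →* Matrix.unitaryGroup (Fin N) ℂ}

theorem IsFaithfulRep.contMDiff_repFun (hρ : IsFaithfulRep (d := d) ρ) :
    ContMDiff (𝓡 d) 𝓘(ℝ, Fin N → Fin N → ℂ) ∞ (repFun ρ) :=
  contMDiff_pi_space.2 fun i => contMDiff_pi_space.2 fun j => hρ.smooth i j

theorem IsFaithfulRep.mdifferentiableAt_repFun (hρ : IsFaithfulRep (d := d) ρ) (x : G) :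
    MDifferentiableAt (𝓡 d) 𝓘(ℝ, Fin N → Fin N → ℂ) (repFun ρ) x :=
  hρ.contMDiff_repFun.mdifferentiableAt (by simp)

theorem IsFaithfulRep.matrixDeriv_eq (hρ : IsFaithfulRep (d := d) ρ) (x : G)
    (u : TangentSpace (𝓡 d) x) :
    matrixDeriv (fun y => (ρ y : Matrix (Fin N) (Fin N) ℂ)) x u = repDeriv ρ x u := by
  ext i j
  exact dirDeriv_clm_comp
    ((ContinuousLinearMap.proj j : (Fin N → ℂ) →L[ℝ] ℂ).comp
      (ContinuousLinearMap.proj i : (Fin N → Fin N → ℂ) →L[ℝ] (Fin N → ℂ)))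
    (hρ.mdifferentiableAt_repFun x) u

/-- The inverse of a unitary matrix is its conjugate transpose, a real-linear operation that
commutes with differentiation. -/
theorem IsFaithfulRep.matrixDeriv_inv_eq (hρ : IsFaithfulRep (d := d) ρ) (x : G)
    (u : TangentSpace (𝓡 d) x) :
    matrixDeriv (fun y => ((ρ y)⁻¹ : Matrix.unitaryGroup (Fin N) ℂ).1) x u
      = (repDeriv ρ x u).conjTranspose := by
  ext i j
  exact dirDeriv_clm_comp
    ((Complex.conjCLE : ℂ →L[ℝ] ℂ).comp ((ContinuousLinearMap.proj i : (Fin N → ℂ) →L[ℝ] ℂ).comp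
      (ContinuousLinearMap.proj j : (Fin N → Fin N → ℂ) →L[ℝ] (Fin N → ℂ))))
    (hρ.mdifferentiableAt_repFun x) u

theorem repDeriv_add (x : G) (u v : TangentSpace (𝓡 d) x) :
    repDeriv ρ x (u + v) = repDeriv ρ x u + repDeriv ρ x v :=
  congrArg Matrix.of (dirDeriv_add_right (repFun ρ) x u v)

theorem repDeriv_smul (x : G) (c : ℝ) (u : TangentSpace (𝓡 d) x) :
    repDeriv ρ x (c • u) = c • repDeriv ρ x u :=
  congrArg Matrix.of (dirDeriv_smul_right (repFun ρ) x c u)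

/-- Differentiate the constant function ρ ρᴴ = 1 at the identity. -/
theorem IsFaithfulRep.repDeriv_one_skew (hρ : IsFaithfulRep (d := d) ρ)
    (u : TangentSpace (𝓡 d) (1 : G)) :
    (repDeriv ρ (1 : G) u).conjTranspose = - repDeriv ρ (1 : G) u := by
  have h1 := dirDeriv_bilin (mulConjTransposeCLM N) (hρ.mdifferentiableAt_repFun 1)
    (hρ.mdifferentiableAt_repFun 1) u
  have h2 : (fun y => mulConjTransposeCLM N (repFun ρ y) (repFun ρ y))
      = fun _ : G => Matrix.of.symm (1 : Matrix (Fin N) (Fin N) ℂ) := by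
    funext y
    exact congrArg Matrix.of.symm <| Matrix.mem_unitaryGroup_iff.1 (ρ y).2
  rw [h2, dirDeriv_const] at h1
  have h3 : (0 : Matrix (Fin N) (Fin N) ℂ)
      = repDeriv ρ (1 : G) u * (ρ 1 : Matrix (Fin N) (Fin N) ℂ).conjTranspose
        + (ρ 1 : Matrix (Fin N) (Fin N) ℂ) * (repDeriv ρ (1 : G) u).conjTranspose :=
    congrArg Matrix.of h1
  rw [map_one, Submonoid.coe_one, Matrix.conjTranspose_one, mul_one, one_mul] at h3
  exact (neg_eq_of_add_eq_zero_right h3.symm).symm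

variable [LieGroup (𝓡 d) ∞ G]

theorem IsFaithfulRep.repDeriv_mul_left (hρ : IsFaithfulRep (d := d) ρ) (a : G) {x y : G}
    (h : a * x = y) (v : TangentSpace (𝓡 d) x) :
    repDeriv ρ y (mfderiv (𝓡 d) (𝓡 d) (fun z : G => a * z) x v : Model d)
      = (ρ a : Matrix (Fin N) (Fin N) ℂ) * repDeriv ρ x v := by
  subst h
  have h1 : repFun ρ ∘ (fun z : G => a * z) = fun z => mulLeftCLM (ρ a).1 (repFun ρ z) := by
    funext z
    exact congrArg Matrix.of.symm (congrArg Subtype.val (map_mul ρ a z))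
  have h2 := dirDeriv_clm_comp (mulLeftCLM (ρ a).1) (hρ.mdifferentiableAt_repFun x) v
  rw [← h1] at h2
  unfold dirDeriv at h2
  rw [mfderiv_comp (I' := 𝓡 d) x (hρ.mdifferentiableAt_repFun _)
    (mdifferentiableAt_mul_left a x)] at h2
  exact congrArg Matrix.of h2

theorem IsFaithfulRep.repDeriv_mulInvariantVectorField (hρ : IsFaithfulRep (d := d) ρ) (x : G)
    (v : Alg d G) :
    repDeriv ρ x (mulInvariantVectorField v x)
      = (ρ x : Matrix (Fin N) (Fin N) ℂ) * repDeriv ρ (1 : G) v :=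
  hρ.repDeriv_mul_left x (mul_one x) v

theorem IsFaithfulRep.repDeriv_eq (hρ : IsFaithfulRep (d := d) ρ) (x : G)
    (u : TangentSpace (𝓡 d) x) :
    repDeriv ρ x u = (ρ x : Matrix (Fin N) (Fin N) ℂ) * repDeriv ρ (1 : G) (maurerCartan x u) := by
  rw [← hρ.repDeriv_mulInvariantVectorField, mulInvariantVectorField_maurerCartan]

theorem diffField_mulInvariantVectorField (v : Alg d G) (x : G) :
    DiffField (mulInvariantVectorField v) x :=
  (contMDiff_mulInvariantVectorField_infty v).mdifferentiableAt (by simp)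

/-- Along the left-invariant field of `v`, the derivative of ρ is ρ · dρ(v). Iterating this in the
commutator formula gives the commutator of matrices. -/
theorem IsFaithfulRep.repDeriv_lie (hρ : IsFaithfulRep (d := d) ρ) (A B : Alg d G) :
    repDeriv ρ (1 : G) ⁅A, B⁆ = repDeriv ρ (1 : G) A * repDeriv ρ (1 : G) B
      - repDeriv ρ (1 : G) B * repDeriv ρ (1 : G) A := by
  have h1 : ∀ v : Alg d G, (fun y => dirDeriv (repFun ρ) y (mulInvariantVectorField v y))
      = fun y : G => mulRightCLM (repDeriv ρ (1 : G) v) (repFun ρ y) := by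
    intro v
    funext y
    exact congrArg Matrix.of.symm (hρ.repDeriv_mulInvariantVectorField y v)
  have h2 : ∀ v : Alg d G, MDifferentiableAt (𝓡 d) 𝓘(ℝ, Fin N → Fin N → ℂ)
      (fun y : G => dirDeriv (repFun ρ) y (mulInvariantVectorField v y)) 1 := by
    intro v
    rw [h1]
    exact (mulRightCLM (repDeriv ρ (1 : G) v)).mdifferentiableAt.comp (1 : G)
      (hρ.mdifferentiableAt_repFun 1)
  have h3 := dirDeriv_mlieBracket hρ.contMDiff_repFun (diffField_mulInvariantVectorField A 1)
    (diffField_mulInvariantVectorField B 1) (h2 A) (h2 B)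
  rw [h1, h1, dirDeriv_clm_comp _ (hρ.mdifferentiableAt_repFun 1),
    dirDeriv_clm_comp _ (hρ.mdifferentiableAt_repFun 1), mulInvariantVectorField_one,
    mulInvariantVectorField_one] at h3
  exact congrArg Matrix.of h3

/-- Along an integral curve of the left-invariant field of `A`, ρ has zero derivative, hence is
constant. Faithfulness makes the curve itself constant, so its velocity vanishes. -/
theorem IsFaithfulRep.repDeriv_injective (hρ : IsFaithfulRep (d := d) ρ) {A : Alg d G}
    (hA : repDeriv ρ (1 : G) A = 0) : A = 0 := by
  have hM1 : IsManifold (𝓡 d) 1 G := IsManifold.of_le (n := ∞) (by norm_cast)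
  obtain ⟨γ, hγ0, hγ⟩ := exists_isMIntegralCurveAt_of_contMDiffAt_boundaryless (I := 𝓡 d) (t₀ := 0)
    ((contMDiff_mulInvariantVectorField_infty A).contMDiffAt.of_le (x := (1 : G))
      (by norm_cast))
  obtain ⟨ε, hε, hball⟩ := Metric.eventually_nhds_iff_ball.1 hγ
  have hderiv : ∀ t ∈ Metric.ball (0 : ℝ) ε, HasFDerivAt (repFun ρ ∘ γ)
      (0 : ℝ →L[ℝ] (Fin N → Fin N → ℂ)) t := by
    intro t ht
    have h1 := ((hρ.mdifferentiableAt_repFun (γ t)).hasMFDerivAt.comp t (hball t ht)).hasFDerivAt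
    refine HasFDerivAt.congr_fderiv h1 (ContinuousLinearMap.ext_ring ?_)
    have h2 := hρ.repDeriv_mulInvariantVectorField (γ t) A
    rw [hA, mul_zero] at h2
    have h3 : dirDeriv (repFun ρ) (γ t) (mulInvariantVectorField A (γ t)) = 0 :=
      congrArg Matrix.of.symm h2
    have h4 : ((1 : ℝ →L[ℝ] ℝ).smulRight (mulInvariantVectorField A (γ t)) : ℝ →L[ℝ] _) 1
      = mulInvariantVectorField A (γ t) := by simp
    have h5 : dirDeriv (repFun ρ) (γ t)
        (((1 : ℝ →L[ℝ] ℝ).smulRight (mulInvariantVectorField A (γ t)) : ℝ →L[ℝ] _) 1) = 0 := by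
      rw [h4, h3]
    exact h5
  have hconst : ∀ t ∈ Metric.ball (0 : ℝ) ε, γ t = γ 0 := by
    intro t ht
    have h1 := (convex_ball (0 : ℝ) ε).is_const_of_fderivWithin_eq_zero (𝕜 := ℝ)
      (f := repFun ρ ∘ γ) (fun s hs => (hderiv s hs).differentiableAt.differentiableWithinAt)
      (fun s hs => by
        rw [fderivWithin_of_isOpen Metric.isOpen_ball hs]
        exact (hderiv s hs).fderiv) ht (Metric.mem_ball_self hε)
    exact hρ.injective (Subtype.ext (congrArg Matrix.of h1))
  have h1 : HasMFDerivAt 𝓘(ℝ, ℝ) (𝓡 d) (fun _ : ℝ => γ 0) 0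
      ((1 : ℝ →L[ℝ] ℝ).smulRight (mulInvariantVectorField A (γ 0))) := by
    refine hγ.hasMFDerivAt.congr_of_eventuallyEq ?_
    filter_upwards [Metric.ball_mem_nhds (0 : ℝ) hε] with t ht
    exact (hconst t ht).symm
  have h2 := hasMFDerivAt_unique h1 (hasMFDerivAt_const (γ 0) (0 : ℝ))
  have h3 := congrArg (fun T : ℝ →L[ℝ] TangentSpace (𝓡 d) (γ 0) => T 1) h2
  have h4 : mulInvariantVectorField A (γ 0) = 0 := by
    have h5 : ((1 : ℝ →L[ℝ] ℝ).smulRight (mulInvariantVectorField A (γ 0)) : ℝ →L[ℝ] _) 1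
      = mulInvariantVectorField A (γ 0) := by simp
    exact h5.symm.trans h3
  exact (leftFrame (γ 0)).map_eq_zero_iff.1 h4

end Representation

end Samelson

namespace Samelson

/-! ### The trace form on the Lie algebra. -/

section KillingForm

open scoped ComplexOrder

variable {d : ℕ} {G : Type*} [TopologicalSpace G] [ChartedSpace (Model d) G] [Group G]
  [LieGroup (𝓡 d) ∞ G] {N : ℕ}

/-- The form `(1/C) Re Tr (dρ A (dρ B)ᴴ)` on the Lie algebra. -/
noncomputable def killingForm (ρ : G →* Matrix.unitaryGroup (Fin N) ℂ) (C : ℝ) :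
    LinearMap.BilinForm ℝ (Alg d G) :=
  LinearMap.mk₂ ℝ
    (fun A B => C⁻¹ * (repDeriv ρ (1 : G) A * (repDeriv ρ (1 : G) B).conjTranspose).trace.re)
    (fun A A' B => by
      rw [repDeriv_add, add_mul, Matrix.trace_add, Complex.add_re, mul_add])
    (fun c A B => by
      rw [repDeriv_smul, smul_mul_assoc, Matrix.trace_smul, Complex.smul_re, smul_eq_mul,
        smul_eq_mul, mul_left_comm])
    (fun A B B' => by
      rw [repDeriv_add, Matrix.conjTranspose_add, mul_add, Matrix.trace_add, Complex.add_re,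
        mul_add])
    (fun c A B => by
      rw [repDeriv_smul, Matrix.conjTranspose_smul, star_trivial, mul_smul_comm,
        Matrix.trace_smul, Complex.smul_re, smul_eq_mul, smul_eq_mul, mul_left_comm])

omit [LieGroup (𝓡 d) ∞ G] in
theorem killingForm_apply (ρ : G →* Matrix.unitaryGroup (Fin N) ℂ) (C : ℝ) (A B : Alg d G) :
    killingForm ρ C A B
      = C⁻¹ * (repDeriv ρ (1 : G) A * (repDeriv ρ (1 : G) B).conjTranspose).trace.re := rfl

variable {ρ : G →* Matrix.unitaryGroup (Fin N) ℂ}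

/-- Symmetry and invariance are cyclicity of the trace for skew-Hermitian matrices; positivity is
Tr(M Mᴴ) > 0 for M ≠ 0, with M ≠ 0 by injectivity of the derivative. -/
theorem IsFaithfulRep.killingForm_isInvariantInner (hρ : IsFaithfulRep (d := d) ρ) {C : ℝ}
    (hC : 0 < C) : IsInvariantInner (killingForm (d := d) ρ C) where
  symm A B := by
    rw [killingForm_apply, killingForm_apply, hρ.repDeriv_one_skew, hρ.repDeriv_one_skew,
      mul_neg, mul_neg, Matrix.trace_neg, Matrix.trace_neg, Matrix.trace_mul_comm]
  pos A hA := by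
    rw [killingForm_apply]
    refine mul_pos (inv_pos.2 hC) ?_
    have h1 := (Matrix.posSemidef_self_mul_conjTranspose (repDeriv ρ (1 : G) A)).trace_nonneg
    have h2 : (repDeriv ρ (1 : G) A * (repDeriv ρ (1 : G) A).conjTranspose).trace ≠ 0 := fun h =>
      hA (hρ.repDeriv_injective (Matrix.trace_mul_conjTranspose_self_eq_zero_iff.1 h))
    exact (Complex.pos_iff.1 (lt_of_le_of_ne h1 h2.symm)).1
  inv A B D := by
    rw [killingForm_apply, killingForm_apply, hρ.repDeriv_one_skew, hρ.repDeriv_one_skew,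
      hρ.repDeriv_lie, hρ.repDeriv_lie, ← mul_neg, ← Complex.neg_re, ← Matrix.trace_neg]
    congr 2
    simp only [sub_mul, mul_sub, mul_neg, Matrix.trace_neg, Matrix.trace_sub, neg_neg]
    rw [mul_assoc, mul_assoc, Matrix.trace_mul_comm (repDeriv ρ (1 : G) A), mul_assoc]
    ring

omit [LieGroup (𝓡 d) ∞ G] in
theorem IsFaithfulRep.ofReal_killingForm (hρ : IsFaithfulRep (d := d) ρ) (C : ℝ) (A B : Alg d G) :
    ((killingForm ρ C A B : ℝ) : ℂ) = (1 / (C : ℂ))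
      * (repDeriv ρ (1 : G) A * (repDeriv ρ (1 : G) B).conjTranspose).trace := by
  have h1 : (starRingEnd ℂ)
      (repDeriv ρ (1 : G) A * (repDeriv ρ (1 : G) B).conjTranspose).trace
      = (repDeriv ρ (1 : G) A * (repDeriv ρ (1 : G) B).conjTranspose).trace := by
    rw [starRingEnd_apply, ← Matrix.trace_conjTranspose, Matrix.conjTranspose_mul,
      Matrix.conjTranspose_conjTranspose, hρ.repDeriv_one_skew, hρ.repDeriv_one_skew,
      mul_neg, mul_neg, Matrix.trace_neg, Matrix.trace_neg, Matrix.trace_mul_comm]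
  rw [killingForm_apply, Complex.ofReal_mul, Complex.conj_eq_iff_re.1 h1, Complex.ofReal_inv,
    one_div]

end KillingForm

/-! ### The left-invariant Riemannian metric. -/

section LeftMetric

variable {d : ℕ} {G : Type*} [TopologicalSpace G] [ChartedSpace (Model d) G] [Group G]
  [LieGroup (𝓡 d) ∞ G]

instance instFiniteDimensionalAlg : FiniteDimensional ℝ (Alg d G) :=
  inferInstanceAs (FiniteDimensional ℝ (Model d))

omit [LieGroup (𝓡 d) ∞ G] in
theorem finrank_alg : Module.finrank ℝ (Alg d G) = d :=
  finrank_euclideanSpace_fin (𝕜 := ℝ) (n := d)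

/-- The minimum `c` of the form on the compact unit sphere gives `c * ‖v‖ ^ 2 ≤ T v v`. An empty
sphere (the zero space) is treated apart. -/
theorem isVonNBounded_of_posDef {V : Type*} [NormedAddCommGroup V] [NormedSpace ℝ V]
    [FiniteDimensional ℝ V] (T : V →L[ℝ] V →L[ℝ] ℝ) (hT : ∀ v, v ≠ 0 → 0 < T v v) :
    Bornology.IsVonNBounded ℝ {v : V | T v v < 1} := by
  rw [NormedSpace.isVonNBounded_iff]
  have hcont : Continuous fun v : V => T v v := T.continuous.clm_apply continuous_id
  have hproper : ProperSpace V := FiniteDimensional.proper ℝ V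
  have hcpt : IsCompact (Metric.sphere (0 : V) 1) := isCompact_sphere 0 1
  obtain ⟨c, hc, hcT⟩ : ∃ c > 0, ∀ v ∈ Metric.sphere (0 : V) 1, c ≤ T v v := by
    rcases (Metric.sphere (0 : V) 1).eq_empty_or_nonempty with he | hne
    · exact ⟨1, one_pos, by simp [he]⟩
    · obtain ⟨v, hv, hmin⟩ := hcpt.exists_isMinOn hne hcont.continuousOn
      exact ⟨T v v, hT v (ne_zero_of_mem_unit_sphere ⟨v, hv⟩), fun w hw => hmin hw⟩
  refine (Metric.isBounded_iff_subset_closedBall 0).2 ⟨Real.sqrt c⁻¹, fun v hv => ?_⟩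
  rw [mem_closedBall_zero_iff]
  by_cases h0 : v = 0
  · simp [h0]
  have hn : 0 < ‖v‖ := norm_pos_iff.2 h0
  have h1 := hcT (‖v‖⁻¹ • v) (by simp [norm_smul, hn.ne'])
  have h2 : c * ‖v‖ ^ 2 ≤ T v v := by
    have h3 : T v v = ‖v‖ ^ 2 * T (‖v‖⁻¹ • v) (‖v‖⁻¹ • v) := by
      simp only [map_smul, _root_.smul_apply, smul_eq_mul]
      field_simp
    rw [h3, mul_comm]
    exact mul_le_mul_of_nonneg_left h1 (by positivity)
  refine Real.le_sqrt_of_sq_le ?_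
  rw [← one_div, le_div_iff₀ hc, mul_comm]
  exact h2.trans (le_of_lt hv)

/-- A bilinear form on the Lie algebra as a continuous bilinear map. -/
noncomputable def formCLM (κ : LinearMap.BilinForm ℝ (Alg d G)) :
    Model d →L[ℝ] Model d →L[ℝ] ℝ :=
  LinearMap.toContinuousBilinearMap (E := Model d) (F := Model d) κ

/-- The left translates of a bilinear form on the Lie algebra. -/
noncomputable def leftForm (κ : LinearMap.BilinForm ℝ (Alg d G)) (x : G) :
    TangentSpace (𝓡 d) x →L[ℝ] TangentSpace (𝓡 d) x →L[ℝ] ℝ :=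
  let S : Model d →L[ℝ] Model d :=
    (leftFrame (d := d) x).symm.toContinuousLinearMap
  ((formCLM κ).bilinearComp S S : Model d →L[ℝ] Model d →L[ℝ] ℝ)

/-- The frame criterion, applied once per argument, leaves the constant coefficient `κ w w'`. -/
theorem contMDiff_leftForm (κ : LinearMap.BilinForm ℝ (Alg d G)) :
    ContMDiff (𝓡 d) ((𝓡 d).prod 𝓘(ℝ, Model d →L[ℝ] Model d →L[ℝ] ℝ)) ∞
      (fun x : G => TotalSpace.mk' (Model d →L[ℝ] Model d →L[ℝ] ℝ)
        (E := fun x : G => TangentSpace (𝓡 d) x →L[ℝ] TangentSpace (𝓡 d) x →L[ℝ] ℝ)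
        x (leftForm κ x)) := by
  intro x₀
  refine contMDiffAt_hom_of_frame (F₁ := Model d) (F₂ := Model d →L[ℝ] ℝ)
    (E₁ := fun x : G => TangentSpace (𝓡 d) x)
    (E₂ := fun x : G => TangentSpace (𝓡 d) x →L[ℝ] ℝ) leftFrame (leftForm κ)
    (fun w => (contMDiff_mulInvariantVectorField_infty w).contMDiffAt) fun w => ?_
  refine contMDiffAt_hom_of_frame (F₁ := Model d) (F₂ := ℝ)
    (E₁ := fun x : G => TangentSpace (𝓡 d) x)
    (E₂ := fun _ : G => ℝ) leftFrame (fun x => leftForm κ x (leftFrame x w))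
    (fun w => (contMDiff_mulInvariantVectorField_infty w).contMDiffAt) fun w' => ?_
  rw [Bundle.contMDiffAt_section]
  have h1 : ∀ x : G, leftForm κ x (leftFrame x w) (leftFrame x w') = κ w w' := fun x =>
    congrArg₂ (fun A B => κ A B) (maurerCartan_mulInvariantVectorField (w : Alg d G) x)
      (maurerCartan_mulInvariantVectorField (w' : Alg d G) x)
  simp only [h1]
  exact contMDiffAt_const

/-- The left-invariant Riemannian metric with a given value on the Lie algebra. -/
noncomputable def leftMetric (κ : LinearMap.BilinForm ℝ (Alg d G)) (hκ : IsInvariantInner κ) :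
    Metric d G where
  inner := leftForm κ
  symm _ _ _ := hκ.symm _ _
  pos x _ hu := hκ.pos _ fun h => hu ((leftFrame x).symm.map_eq_zero_iff.1 h)
  isVonNBounded x := isVonNBounded_of_posDef (V := Model d) (leftForm κ x)
    fun _ (hu : _ ≠ (0 : Model d)) => hκ.pos _ fun h => hu ((leftFrame x).symm.map_eq_zero_iff.1 h)
  contMDiff := contMDiff_leftForm κ

theorem leftMetric_inner (κ : LinearMap.BilinForm ℝ (Alg d G)) (hκ : IsInvariantInner κ) (x : G)
    (u v : TangentSpace (𝓡 d) x) :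
    (leftMetric κ hκ).inner x u v = κ (maurerCartan x u) (maurerCartan x v) := rfl

theorem leftMetric_inner_one (κ : LinearMap.BilinForm ℝ (Alg d G)) (hκ : IsInvariantInner κ)
    (A B : Alg d G) : (leftMetric κ hκ).inner (1 : G) A B = κ A B := by
  rw [leftMetric_inner, maurerCartan_one, maurerCartan_one]

/-- Left translation multiplies dρ by the unitary matrix `ρ x`, which cancels in the trace. -/
theorem IsFaithfulRep.isKillingMetric {N : ℕ} {ρ : G →* Matrix.unitaryGroup (Fin N) ℂ}
    (hρ : IsFaithfulRep (d := d) ρ) {C : ℝ} (hC : 0 < C) :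
    IsKillingMetric ρ C (leftMetric (killingForm ρ C) (hρ.killingForm_isInvariantInner hC)) := by
  intro x u v
  rw [leftMetric_inner, hρ.ofReal_killingForm, hρ.matrixDeriv_eq, hρ.matrixDeriv_inv_eq,
    hρ.repDeriv_eq x u, hρ.repDeriv_eq x v, Matrix.conjTranspose_mul, mul_assoc,
    Matrix.trace_mul_comm (ρ x).1, mul_assoc, mul_assoc, ← Matrix.star_eq_conjTranspose (ρ x).1,
    Matrix.mem_unitaryGroup_iff'.1 (ρ x).2, mul_one]

end LeftMetric

end Samelson

namespace Samelson

/-! ### The left connection and its half-bracket modification. -/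

section Connections

variable {d : ℕ} {G : Type*} [TopologicalSpace G] [ChartedSpace (Model d) G] [Group G]
  [LieGroup (𝓡 d) ∞ G]

/-- The coordinates of a vector field in the left-invariant frame. -/
noncomputable def frameCoord (Y : (x : G) → TangentSpace (𝓡 d) x) (x : G) : Model d :=
  maurerCartan x (Y x)

theorem mulInvariantVectorField_frameCoord (Y : (x : G) → TangentSpace (𝓡 d) x) (x : G) :
    mulInvariantVectorField (I := 𝓡 d) (frameCoord Y x) x = Y x :=
  mulInvariantVectorField_maurerCartan x (Y x)

theorem frameCoord_mulInvariantVectorField (v : Alg d G) :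
    frameCoord (G := G) (mulInvariantVectorField v) = fun _ => v :=
  funext fun x => maurerCartan_mulInvariantVectorField v x

/-- The inverse frame is a smooth map to the trivial bundle, because it sends each frame field to a
constant. -/
theorem mdifferentiableAt_frameCoord {Y : (x : G) → TangentSpace (𝓡 d) x} {x : G}
    (hY : DiffField Y x) : MDifferentiableAt (𝓡 d) 𝓘(ℝ, Model d) (frameCoord Y) x := by
  have h1 := contMDiffAt_hom_of_frame (IB := 𝓡 d) (n := ∞) (x₀ := x) (F₁ := Model d)
    (F₂ := Model d) (E₁ := fun x : G => TangentSpace (𝓡 d) x) (E₂ := fun _ : G => Model d)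
    leftFrame (fun x => (leftFrame (d := d) x).symm.toContinuousLinearMap)
    (fun w => (contMDiff_mulInvariantVectorField_infty w).contMDiffAt) fun w => by
      rw [Bundle.contMDiffAt_section]
      have h2 : ∀ x : G, (leftFrame x).symm (leftFrame x w) = w := fun x =>
        (leftFrame x).symm_apply_apply w
      simp only [ContinuousLinearEquiv.coe_coe, h2]
      exact contMDiffAt_const
  have h2 := (h1.mdifferentiableAt (by simp)).clm_bundle_apply (b := fun y => y) hY
  exact (mdifferentiableAt_section (𝓡 d) _).1 h2

/-- The connection for which left-invariant vector fields are parallel. -/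
noncomputable def leftConnection (d : ℕ) (G : Type*) [TopologicalSpace G]
    [ChartedSpace (Model d) G] [Group G] [LieGroup (𝓡 d) ∞ G] : Connection d G where
  toFun Y x := (leftFrame (d := d) x).toContinuousLinearMap.comp
    (mvfderiv (𝓡 d) (frameCoord Y) x)
  isCovariantDerivativeOnUniv :=
    { add := by
        intro Y Y' x hY hY' _
        have h1 : frameCoord (Y + Y') = frameCoord Y + frameCoord Y' :=
          funext fun y => map_add (leftFrame y).symm (Y y) (Y' y)
        rw [h1, mvfderiv_add (mdifferentiableAt_frameCoord hY) (mdifferentiableAt_frameCoord hY'),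
          ContinuousLinearMap.comp_add]
      leibniz := by
        intro Y f x hY hf _
        have h1 : frameCoord (f • Y) = f • frameCoord Y :=
          funext fun y => map_smul (leftFrame y).symm (f y) (Y y)
        rw [h1, mvfderiv_smul hf (mdifferentiableAt_frameCoord hY)]
        ext1 u
        exact (map_add (leftFrame x) _ _).trans
          (congrArg₂ (· + ·) (map_smul (leftFrame x) (f x) _)
            ((map_smul (leftFrame x) (mvfderiv (𝓡 d) f x u) (frameCoord Y x)).trans
              (congrArg _ (mulInvariantVectorField_frameCoord Y x)))) }

theorem leftConnection_apply (Y : (x : G) → TangentSpace (𝓡 d) x) (x : G)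
    (u : TangentSpace (𝓡 d) x) :
    leftConnection d G Y x u = leftFrame x (dirDeriv (frameCoord Y) x u) := rfl

/-- The bracket of the Lie algebra as a continuous bilinear map. -/
noncomputable def lieCLM (d : ℕ) (G : Type*) [TopologicalSpace G] [ChartedSpace (Model d) G]
    [Group G] [LieGroup (𝓡 d) ∞ G] : Model d →L[ℝ] Model d →L[ℝ] Model d :=
  LinearMap.toContinuousBilinearMap (E := Model d) (F := Model d) (G := Model d)
    (LinearMap.mk₂ ℝ (fun A B : Alg d G => ⁅A, B⁆) add_lie smul_lie lie_add
      (fun c A B => lie_smul c A B) : Alg d G →ₗ[ℝ] Alg d G →ₗ[ℝ] Alg d G)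

/-- The left-invariant 2-form with values in the tangent bundle given by half the bracket. -/
noncomputable def halfBracket (x : G) :
    TangentSpace (𝓡 d) x →L[ℝ] TangentSpace (𝓡 d) x →L[ℝ] TangentSpace (𝓡 d) x :=
  let S : Model d →L[ℝ] Model d := (leftFrame (d := d) x).symm.toContinuousLinearMap
  let T : Model d →L[ℝ] Model d := (leftFrame (d := d) x).toContinuousLinearMap
  ((ContinuousLinearMap.compL ℝ (Model d) (Model d) (Model d) T).comp
    ((-(1 / 2 : ℝ)) • (lieCLM d G).bilinearComp S S) :
      Model d →L[ℝ] Model d →L[ℝ] Model d)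

/-- The first argument is the value of the field and the second the direction, hence the minus sign:
the result is half the bracket of direction with field. -/
theorem halfBracket_apply (x : G) (u v : TangentSpace (𝓡 d) x) :
    halfBracket x v u
      = mulInvariantVectorField (-(1 / 2 : ℝ) • ⁅maurerCartan x v, maurerCartan x u⁆) x := rfl

/-- The connection `∇_u Y = ∇'_u Y + (1/2) [u, Y]`, where `∇'` is the left connection. -/
noncomputable def halfConnection (d : ℕ) (G : Type*) [TopologicalSpace G]
    [ChartedSpace (Model d) G] [Group G] [LieGroup (𝓡 d) ∞ G] : Connection d G :=
  (leftConnection d G).addOneForm halfBracket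

theorem halfConnection_apply (Y : (x : G) → TangentSpace (𝓡 d) x) (x : G)
    (u : TangentSpace (𝓡 d) x) :
    halfConnection d G Y x u = leftConnection d G Y x u + halfBracket x (Y x) u := rfl

theorem leftConnection_mulInvariantVectorField (v : Alg d G) (x : G)
    (u : TangentSpace (𝓡 d) x) :
    leftConnection d G (mulInvariantVectorField v) x u = 0 := by
  rw [leftConnection_apply, frameCoord_mulInvariantVectorField]
  exact (congrArg (leftFrame x) (dirDeriv_const (F := Model d) v x u)).trans (map_zero (leftFrame x))

theorem halfConnection_mulInvariantVectorField (v : Alg d G) (x : G)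
    (u : TangentSpace (𝓡 d) x) :
    halfConnection d G (mulInvariantVectorField v) x u
      = mulInvariantVectorField ((1 / 2 : ℝ) • ⁅maurerCartan x u, v⁆) x := by
  rw [halfConnection_apply, leftConnection_mulInvariantVectorField, zero_add, halfBracket_apply,
    maurerCartan_mulInvariantVectorField, ← lie_skew, smul_neg, neg_smul, neg_neg]

theorem mlieBracket_mulInvariantVectorField (v w : Alg d G) (x : G) :
    mlieBracket (𝓡 d) (mulInvariantVectorField v) (mulInvariantVectorField w) x
      = mulInvariantVectorField ⁅v, w⁆ x := by
  rw [GroupLieAlgebra.bracket_def, mulInvariantVector_mlieBracket]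

end Connections

end Samelson

namespace Samelson

/-! ### The Levi-Civita and Bismut connections. -/

section LeviCivita

variable {d : ℕ} {G : Type*} [TopologicalSpace G] [ChartedSpace (Model d) G] [Group G]
  [LieGroup (𝓡 d) ∞ G]

theorem mulInvariantVectorField_sub_apply (v w : Alg d G) (x : G) :
    mulInvariantVectorField (v - w) x
      = mulInvariantVectorField v x - mulInvariantVectorField w x := map_sub (leftFrame x) v w

theorem mulInvariantVectorField_add_apply (v w : Alg d G) (x : G) :
    mulInvariantVectorField (v + w) x
      = mulInvariantVectorField v x + mulInvariantVectorField w x := map_add (leftFrame x) v w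

/-- Torsion is a tensor, so left-invariant extensions suffice; there it is ½[u,v] - ½[v,u] - [u,v].
-/
theorem halfConnection_torsion [IsManifold (𝓡 d) 2 G] : (halfConnection d G).torsion = 0 := by
  funext x
  refine ContinuousLinearMap.ext fun u => ContinuousLinearMap.ext fun v => ?_
  have h1 := (halfConnection d G).torsion_apply
    (diffField_mulInvariantVectorField (maurerCartan x u) x)
    (diffField_mulInvariantVectorField (maurerCartan x v) x)
  rw [halfConnection_mulInvariantVectorField, halfConnection_mulInvariantVectorField,
    mlieBracket_mulInvariantVectorField, mulInvariantVectorField_maurerCartan,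
    mulInvariantVectorField_maurerCartan, ← mulInvariantVectorField_sub_apply,
    ← mulInvariantVectorField_sub_apply] at h1
  refine h1.trans ?_
  have h2 : (1 / 2 : ℝ) • ⁅maurerCartan x u, maurerCartan x v⁆
      - (1 / 2 : ℝ) • ⁅maurerCartan x v, maurerCartan x u⁆
      - ⁅maurerCartan x u, maurerCartan x v⁆ = 0 := by
    rw [← lie_skew (maurerCartan x u) (maurerCartan x v)]
    module
  rw [h2]
  exact map_zero (leftFrame x)

variable {κ : LinearMap.BilinForm ℝ (Alg d G)} (hκ : IsInvariantInner κ)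

theorem leftMetric_inner_mulInvariantVectorField (v w : Alg d G) (x : G) :
    (leftMetric κ hκ).inner x (mulInvariantVectorField v x) (mulInvariantVectorField w x)
      = κ v w := by
  rw [leftMetric_inner, maurerCartan_mulInvariantVectorField,
    maurerCartan_mulInvariantVectorField]

/-- Left-invariant fields have constant inner products, and the two half-bracket terms cancel
because κ is invariant. -/
theorem isLeviCivita_halfConnection : IsLeviCivita (leftMetric κ hκ) (halfConnection d G) := by
  let _ : RiemannianBundle (fun x : G => TangentSpace (𝓡 d) x) :=
    ⟨(leftMetric κ hκ).toRiemannianMetric⟩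
  have _ : IsManifold (𝓡 d) 2 G := IsManifold.of_le (n := ∞) (by norm_cast)
  refine ⟨?_, halfConnection_torsion⟩
  funext x
  refine ContinuousLinearMap.ext fun u => ContinuousLinearMap.ext fun v =>
    ContinuousLinearMap.ext fun w => ?_
  set a := maurerCartan x u
  set b := maurerCartan x v
  have h1 := (halfConnection d G).derivMetricTensor_apply
    (X := mulInvariantVectorField (maurerCartan x w)) x
    (diffField_mulInvariantVectorField a x) (diffField_mulInvariantVectorField b x)
  have h2 : (fun y : G => inner ℝ (mulInvariantVectorField a y) (mulInvariantVectorField b y))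
      = fun _ => κ a b := funext fun y => leftMetric_inner_mulInvariantVectorField hκ a b y
  have h3 : mvfderiv (𝓡 d) (fun y : G => inner ℝ (mulInvariantVectorField a y)
      (mulInvariantVectorField b y)) x (mulInvariantVectorField (maurerCartan x w) x) = 0 := by
    rw [h2]
    exact dirDeriv_const (κ a b) x _
  have h4 : ∀ c e : Alg d G, inner ℝ (halfConnection d G (mulInvariantVectorField c) x
      (mulInvariantVectorField (maurerCartan x w) x)) (mulInvariantVectorField e x)
      = (1 / 2 : ℝ) * κ ⁅maurerCartan x w, c⁆ e := fun c e => by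
    rw [halfConnection_mulInvariantVectorField, maurerCartan_mulInvariantVectorField]
    exact (leftMetric_inner_mulInvariantVectorField hκ _ e x).trans
      (by rw [map_smul, LinearMap.smul_apply, smul_eq_mul])
  have h5 : inner ℝ (mulInvariantVectorField a x) (halfConnection d G (mulInvariantVectorField b) x
      (mulInvariantVectorField (maurerCartan x w) x))
      = (1 / 2 : ℝ) * κ a ⁅maurerCartan x w, b⁆ := by
    rw [halfConnection_mulInvariantVectorField, maurerCartan_mulInvariantVectorField]
    exact (leftMetric_inner_mulInvariantVectorField hκ a _ x).trans
      (by rw [map_smul, smul_eq_mul])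
  beta_reduce at h1
  rw [h3, h4, h5, hκ.inv, mulInvariantVectorField_maurerCartan,
    mulInvariantVectorField_maurerCartan, mulInvariantVectorField_maurerCartan] at h1
  refine h1.trans ?_
  simp

/-- By cyclic symmetry of `κ ⁅·, ·⁆ ·`, the torsion term cancels exactly the half bracket in the
Levi-Civita connection. -/
theorem isBismutConnection_leftConnection :
    IsBismutConnection (leftMetric κ hκ) (structureTensor (leftMetric κ hκ))
      (leftConnection d G) := by
  have hf : ∀ (x : G) (u v w : TangentSpace (𝓡 d) x),
      structureTensor (leftMetric κ hκ) x u v w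
        = - κ ⁅maurerCartan x u, maurerCartan x v⁆ (maurerCartan x w) := fun x u v w =>
    congrArg Neg.neg (leftMetric_inner_one κ hκ _ _)
  refine ⟨fun x u v w => ⟨?_, ?_⟩, halfConnection d G, isLeviCivita_halfConnection hκ,
    fun x Y _ u w => ?_⟩
  · rw [hf, hf, ← lie_skew, map_neg, LinearMap.neg_apply]
  · rw [hf, hf, hκ.inv, hκ.symm]
  · rw [hf, halfConnection_apply, map_add, _root_.add_apply, halfBracket_apply, leftMetric_inner,
      leftMetric_inner, maurerCartan_mulInvariantVectorField, map_smul, LinearMap.smul_apply,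
      smul_eq_mul, hκ.inv (maurerCartan x w), hκ.inv (maurerCartan x (Y x)),
      ← lie_skew (maurerCartan x w), map_neg]
    ring

end LeviCivita

end Samelson

namespace Samelson

/-! ### Tensoriality of the Nijenhuis tensor. -/

section NijenhuisTensor

variable {d : ℕ} {M : Type*} [TopologicalSpace M] [ChartedSpace (Model d) M]
  [IsManifold (𝓡 d) ∞ M] {J : EndField d M}

/-- The smoothness condition on a field of endomorphisms. -/
def IsSmoothEndField (J : EndField d M) : Prop :=
  ContMDiff (𝓡 d) ((𝓡 d).prod 𝓘(ℝ, Model d →L[ℝ] Model d)) ∞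
    (fun x : M => TotalSpace.mk' (Model d →L[ℝ] Model d)
      (E := fun x : M => TangentSpace (𝓡 d) x →L[ℝ] TangentSpace (𝓡 d) x) x (J x))

theorem IsSmoothEndField.diffField (hJ : IsSmoothEndField J)
    {X : (x : M) → TangentSpace (𝓡 d) x} {x : M} (hX : DiffField X x) :
    DiffField (fun y => J y (X y)) x :=
  (hJ.contMDiffAt.mdifferentiableAt (by simp)).clm_bundle_apply (b := fun y => y) hX

omit [IsManifold (𝓡 d) ∞ M] in
theorem nijenhuis_swap (J : EndField d M) (X Y : (x : M) → TangentSpace (𝓡 d) x) (x : M) :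
    nijenhuis J X Y x = - nijenhuis J Y X x := by
  unfold nijenhuis
  rw [mlieBracket_swap_apply (V := X) (W := Y),
    mlieBracket_swap_apply (V := fun y => J y (X y)) (W := Y),
    mlieBracket_swap_apply (V := X) (W := fun y => J y (Y y)),
    mlieBracket_swap_apply (V := fun y => J y (X y)) (W := fun y => J y (Y y)), map_neg, map_neg]
  abel

/-- The terms with Y(f) cancel by J² = -1, and those with (JY)(f) cancel directly. -/
theorem IsSmoothEndField.tensorialAt_nijenhuis (hJ : IsSmoothEndField J)
    (hsq : ∀ (x : M) (u : TangentSpace (𝓡 d) x), J x (J x u) = -u)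
    (Y : (x : M) → TangentSpace (𝓡 d) x) (x : M) :
    TensorialAt (𝓡 d) (Model d) (fun X : (x : M) → TangentSpace (𝓡 d) x => nijenhuis J X Y x)
      x where
  smul := by
    intro f X hf hX
    have h1 : (fun y => J y ((f • X) y)) = f • fun y => J y (X y) :=
      funext fun y => map_smul (J y) (f y) (X y)
    have hJX := hJ.diffField hX
    unfold nijenhuis
    rw [h1, mlieBracket_smul_left hf hX, mlieBracket_smul_left hf hX,
      mlieBracket_smul_left hf hJX, mlieBracket_smul_left hf hJX]
    simp only [map_add, map_smul, hsq]
    module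
  add := by
    intro X X' hX hX'
    have h1 : (fun y => J y ((X + X') y)) = (fun y => J y (X y)) + fun y => J y (X' y) :=
      funext fun y => map_add (J y) (X y) (X' y)
    unfold nijenhuis
    rw [h1, mlieBracket_add_left hX hX', mlieBracket_add_left hX hX',
      mlieBracket_add_left (hJ.diffField hX) (hJ.diffField hX'),
      mlieBracket_add_left (hJ.diffField hX) (hJ.diffField hX')]
    simp only [map_add]
    module

theorem IsSmoothEndField.nijenhuis_congr (hJ : IsSmoothEndField J)
    (hsq : ∀ (x : M) (u : TangentSpace (𝓡 d) x), J x (J x u) = -u)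
    {X X' Y Y' : (x : M) → TangentSpace (𝓡 d) x} {x : M} (hX : DiffField X x)
    (hX' : DiffField X' x) (hY : DiffField Y x) (hY' : DiffField Y' x) (hXX' : X x = X' x)
    (hYY' : Y x = Y' x) : nijenhuis J X Y x = nijenhuis J X' Y' x := by
  have : IsManifold (𝓡 d) 1 M := IsManifold.of_le (n := ∞) (by norm_cast)
  rw [(hJ.tensorialAt_nijenhuis hsq Y x).pointwise hX hX' hXX', nijenhuis_swap,
    (hJ.tensorialAt_nijenhuis hsq X' x).pointwise hY hY' hYY', ← nijenhuis_swap]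

end NijenhuisTensor

/-! ### Left-invariant endomorphism fields. -/

section LeftInvariant

variable {d : ℕ} {G : Type*} [TopologicalSpace G] [ChartedSpace (Model d) G] [Group G]
  [LieGroup (𝓡 d) ∞ G]

/-- The field of endomorphisms obtained from an endomorphism of the Lie algebra by left
translation. -/
noncomputable def leftEndField (I : Alg d G →L[ℝ] Alg d G) : EndField d G := fun x =>
  let S : Model d →L[ℝ] Model d := (leftFrame (d := d) x).symm.toContinuousLinearMap
  let T : Model d →L[ℝ] Model d := (leftFrame (d := d) x).toContinuousLinearMap
  let I' : Model d →L[ℝ] Model d := I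
  (T.comp (I'.comp S) : Model d →L[ℝ] Model d)

theorem leftEndField_apply (I : Alg d G →L[ℝ] Alg d G) (x : G) (u : TangentSpace (𝓡 d) x) :
    leftEndField I x u = mulInvariantVectorField (I (maurerCartan x u)) x := rfl

theorem leftEndField_one (I : Alg d G →L[ℝ] Alg d G) : leftEndField I 1 = I :=
  ContinuousLinearMap.ext fun u => by
    rw [leftEndField_apply, maurerCartan_one, mulInvariantVectorField_one]

theorem mfderiv_mul_left_mulInvariantVectorField (a x : G) (v : Alg d G) :
    mfderiv (𝓡 d) (𝓡 d) (fun y : G => a * y) x (mulInvariantVectorField v x)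
      = mulInvariantVectorField v (a * x) :=
  mfderiv_mul_left_mul_left (d := d) a x (mul_one x) v

theorem isLeftInvariant_leftEndField (I : Alg d G →L[ℝ] Alg d G) :
    IsLeftInvariant (leftEndField I) := fun a x v => by
  rw [leftEndField_apply, maurerCartan_mfderiv_mul_left, leftEndField_apply,
    mfderiv_mul_left_mulInvariantVectorField]

variable {J : EndField d G}

omit [LieGroup (𝓡 d) ∞ G] in
theorem IsLeftInvariant.apply_mul (hJ : IsLeftInvariant J) {a x y : G} (h : a * x = y)
    (v : TangentSpace (𝓡 d) x) :
    (J y (mfderiv (𝓡 d) (𝓡 d) (fun z : G => a * z) x v : Model d) : Model d)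
      = mfderiv (𝓡 d) (𝓡 d) (fun z : G => a * z) x (J x v) := by
  subst h
  exact hJ a x v

omit [LieGroup (𝓡 d) ∞ G] in
theorem IsLeftInvariant.apply_mulInvariantVectorField (hJ : IsLeftInvariant J) (v : Alg d G)
    (x : G) : J x (mulInvariantVectorField v x) = mulInvariantVectorField (J 1 v) x :=
  hJ.apply_mul (mul_one x) v

theorem IsLeftInvariant.eq_leftEndField (hJ : IsLeftInvariant J) : J = leftEndField (J 1) :=
  funext fun x => ContinuousLinearMap.ext fun u => by
    rw [leftEndField_apply, ← hJ.apply_mulInvariantVectorField,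
      mulInvariantVectorField_maurerCartan]

theorem IsLeftInvariant.maurerCartan_apply (hJ : IsLeftInvariant J) (x : G)
    (u : TangentSpace (𝓡 d) x) : maurerCartan x (J x u) = J 1 (maurerCartan x u) := by
  rw [← maurerCartan_mulInvariantVectorField (J 1 (maurerCartan x u)) x,
    ← hJ.apply_mulInvariantVectorField, mulInvariantVectorField_maurerCartan]

theorem IsLeftInvariant.isSmoothEndField (hJ : IsLeftInvariant J) : IsSmoothEndField J := by
  intro x₀
  refine contMDiffAt_hom_of_frame (F₁ := Model d) (F₂ := Model d)
    (E₁ := fun x : G => TangentSpace (𝓡 d) x)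
    (E₂ := fun x : G => TangentSpace (𝓡 d) x) leftFrame J
    (fun w => (contMDiff_mulInvariantVectorField_infty w).contMDiffAt) fun w => ?_
  have h1 : ∀ x : G, J x (leftFrame x w) = mulInvariantVectorField (J 1 w) x := fun x =>
    hJ.apply_mulInvariantVectorField w x
  simp only [h1]
  exact (contMDiff_mulInvariantVectorField_infty (J 1 w)).contMDiffAt

/-- In the left-invariant frame `J` is the constant endomorphism `J 1`, which commutes with
differentiation of the coordinates. -/
theorem IsLeftInvariant.isParallel (hJ : IsLeftInvariant J) :
    IsParallel (leftConnection d G) J := by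
  intro x Y hY u
  have h1 : frameCoord (fun y => J y (Y y)) =
      fun y => (J 1 : Model d →L[ℝ] Model d) (frameCoord Y y) :=
    funext fun y => hJ.maurerCartan_apply y (Y y)
  rw [leftConnection_apply, leftConnection_apply, h1]
  refine (congrArg (leftFrame x) (dirDeriv_clm_comp (J 1 : Model d →L[ℝ] Model d)
    (mdifferentiableAt_frameCoord hY) u)).trans ?_
  exact (hJ.apply_mulInvariantVectorField _ x).symm

theorem IsLeftInvariant.nijenhuis_mulInvariantVectorField (hJ : IsLeftInvariant J) (v w : Alg d G)
    (x : G) : nijenhuis J (mulInvariantVectorField v) (mulInvariantVectorField w) x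
      = mulInvariantVectorField
        (⁅v, w⁆ + J 1 ⁅J 1 v, w⁆ + J 1 ⁅v, J 1 w⁆ - ⁅J 1 v, J 1 w⁆ : Alg d G) x := by
  have h1 : ∀ v : Alg d G, (fun y => J y (mulInvariantVectorField v y))
      = mulInvariantVectorField (J 1 v) := fun v =>
    funext fun y => hJ.apply_mulInvariantVectorField v y
  unfold nijenhuis
  rw [h1, h1, mlieBracket_mulInvariantVectorField, mlieBracket_mulInvariantVectorField,
    mlieBracket_mulInvariantVectorField, mlieBracket_mulInvariantVectorField,
    hJ.apply_mulInvariantVectorField, hJ.apply_mulInvariantVectorField,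
    mulInvariantVectorField_sub_apply, mulInvariantVectorField_add_apply,
    mulInvariantVectorField_add_apply]

/-- By tensoriality, arbitrary fields may be replaced by left-invariant ones with the same values at
the point. -/
theorem IsLeftInvariant.nijenhuisVanishes_iff (hJ : IsLeftInvariant J)
    (hsq : ∀ v : Alg d G, J 1 (J 1 v) = -v) :
    NijenhuisVanishes J ↔ ∀ v w : Alg d G,
      (⁅v, w⁆ + J 1 ⁅J 1 v, w⁆ + J 1 ⁅v, J 1 w⁆ - ⁅J 1 v, J 1 w⁆ : Alg d G) = 0 := by
  have hsq' : ∀ (x : G) (u : TangentSpace (𝓡 d) x), J x (J x u) = -u := fun x u => by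
    rw [← mulInvariantVectorField_maurerCartan x u, hJ.apply_mulInvariantVectorField,
      hJ.apply_mulInvariantVectorField, hsq]
    exact map_neg (leftFrame x) (maurerCartan x u)
  constructor
  · intro h v w
    have h1 := h 1 _ _ (diffField_mulInvariantVectorField v 1)
      (diffField_mulInvariantVectorField w 1)
    rwa [hJ.nijenhuis_mulInvariantVectorField, mulInvariantVectorField_one] at h1
  · intro h x X Y hX hY
    rw [hJ.isSmoothEndField.nijenhuis_congr hsq' hX
      (diffField_mulInvariantVectorField (maurerCartan x (X x)) x) hY
      (diffField_mulInvariantVectorField (maurerCartan x (Y x)) x)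
      (mulInvariantVectorField_maurerCartan x _).symm
      (mulInvariantVectorField_maurerCartan x _).symm, hJ.nijenhuis_mulInvariantVectorField, h]
    exact map_zero (leftFrame x)

variable {κ : LinearMap.BilinForm ℝ (Alg d G)} (hκ : IsInvariantInner κ)

theorem isAlmostHermitian_of_isLeftInvariant (hJ : IsLeftInvariant J)
    (hsq : ∀ v : Alg d G, J 1 (J 1 v) = -v)
    (hskew : ∀ v w : Alg d G, κ (J 1 v) w = - κ v (J 1 w)) :
    IsAlmostHermitian (leftMetric κ hκ) J where
  smooth := hJ.isSmoothEndField
  skew x u v := by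
    rw [leftMetric_inner, leftMetric_inner, hJ.maurerCartan_apply, hJ.maurerCartan_apply, hskew]
  sq x u := by
    rw [← mulInvariantVectorField_maurerCartan x u, hJ.apply_mulInvariantVectorField,
      hJ.apply_mulInvariantVectorField, hsq]
    exact map_neg (leftFrame x) (maurerCartan x u)

theorem structureConst_leftMetric (X Y Z : Alg d G) :
    structureConst (leftMetric κ hκ) X Y Z = - κ ⁅X, Y⁆ Z :=
  congrArg Neg.neg (leftMetric_inner_one κ hκ _ _)

/-- The left side of the identity is minus the κ-pairing of the Nijenhuis expression with `Z`, by
skewness of `I` and cyclicity; nondegeneracy of κ does the rest. -/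
theorem structureIdentity_iff {I : Alg d G →L[ℝ] Alg d G}
    (hskew : ∀ v w : Alg d G, κ (I v) w = - κ v (I w)) :
    StructureIdentity (leftMetric κ hκ) I ↔ ∀ v w : Alg d G,
      (⁅v, w⁆ + I ⁅I v, w⁆ + I ⁅v, I w⁆ - ⁅I v, I w⁆ : Alg d G) = 0 := by
  have h1 : ∀ X Y Z : Alg d G,
      structureConst (leftMetric κ hκ) X Y Z - structureConst (leftMetric κ hκ) (I X) (I Y) Z
      - structureConst (leftMetric κ hκ) (I Y) (I Z) X
      - structureConst (leftMetric κ hκ) (I Z) (I X) Y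
      = - κ (⁅X, Y⁆ + I ⁅I X, Y⁆ + I ⁅X, I Y⁆ - ⁅I X, I Y⁆ : Alg d G) Z := fun X Y Z => by
    have hcyc : ∀ A B D : Alg d G, κ ⁅A, B⁆ D = κ ⁅B, D⁆ A := fun A B D => by
      rw [← lie_skew, map_neg, LinearMap.neg_apply, hκ.inv, neg_neg, hκ.symm]
    simp only [structureConst_leftMetric, map_add, map_sub, LinearMap.add_apply,
      LinearMap.sub_apply, hskew]
    rw [hcyc X (I Y), hcyc (I Z) (I X)]
    ring
  refine ⟨fun h v w => hκ.eq_zero ?_, fun h X Y Z => ?_⟩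
  · have h2 := h v w (⁅v, w⁆ + I ⁅I v, w⁆ + I ⁅v, I w⁆ - ⁅I v, I w⁆ : Alg d G)
    rw [h1] at h2
    exact neg_eq_zero.1 h2
  · rw [h1, h, map_zero, LinearMap.zero_apply, neg_zero]

end LeftInvariant

end Samelson

namespace Samelson

/-! ### Comparison of complex root vectors with root pairs. -/

section Roots

variable {d : ℕ} {G : Type*} [TopologicalSpace G] [ChartedSpace (Model d) G] [Group G]
  [LieGroup (𝓡 d) ∞ G] {𝔱 : LieSubalgebra ℝ (Alg d G)}

omit [LieGroup (𝓡 d) ∞ G] in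
theorem continuous_endAlg (I : Alg d G →ₗ[ℝ] Alg d G) : Continuous I :=
  let I' : Model d →ₗ[ℝ] Model d := I
  I'.continuous_of_finiteDimensional

theorem isRootVector_iff {α : 𝔱 →ₗ[ℝ] ℝ} {E : ℂ ⊗[ℝ] Alg d G} :
    IsRootVector 𝔱 α E ↔ IsRootPair 𝔱 α (tensorRe E) (tensorIm E) := by
  refine forall_congr' fun t => ?_
  rw [one_tmul_lie, tensor_ext_iff, tensorRe_baseChange, tensorIm_baseChange, tensorRe_smul,
    tensorIm_smul]
  simp

omit [LieGroup (𝓡 d) ∞ G] in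
theorem exists_tensor (X Y : Alg d G) :
    ∃ E : ℂ ⊗[ℝ] Alg d G, tensorRe E = X ∧ tensorIm E = Y :=
  ⟨(1 : ℂ) ⊗ₜ[ℝ] X + Complex.I ⊗ₜ[ℝ] Y, by simp, by simp⟩

theorem roots_eq_rootSet : roots 𝔱 = rootSet 𝔱 := by
  ext α
  refine and_congr_right fun _ => ⟨?_, ?_⟩
  · rintro ⟨E, hE, h⟩
    refine ⟨tensorRe E, tensorIm E, ?_, isRootVector_iff.1 h⟩
    by_contra! h0
    exact hE (tensor_ext_iff.2 (by simpa using h0))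
  · rintro ⟨X, Y, hXY, h⟩
    obtain ⟨E, rfl, rfl⟩ := exists_tensor X Y
    refine ⟨E, ?_, isRootVector_iff.2 h⟩
    rintro rfl
    simp at hXY

theorem isPositiveSystem_iff {P : Set (𝔱 →ₗ[ℝ] ℝ)} :
    IsPositiveSystem 𝔱 P ↔ IsPositiveRootSet 𝔱 P := by
  refine ⟨fun h => ⟨?_, ?_, ?_⟩, fun h => ⟨?_, ?_, ?_⟩⟩
  · exact roots_eq_rootSet (𝔱 := 𝔱) ▸ h.subset
  · exact roots_eq_rootSet (𝔱 := 𝔱) ▸ h.dichotomy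
  · exact roots_eq_rootSet (𝔱 := 𝔱) ▸ h.add_mem
  · exact roots_eq_rootSet (𝔱 := 𝔱) ▸ h.subset
  · exact roots_eq_rootSet (𝔱 := 𝔱) ▸ h.dichotomy
  · exact roots_eq_rootSet (𝔱 := 𝔱) ▸ h.add_mem

/-- The real part of `I E = -i E` says that `I` sends the real part of `E` to the imaginary part.
The remaining conditions follow by rotating a pair and, for negative roots, conjugating it. -/
theorem hasSamelsonAction_iff {P : Set (𝔱 →ₗ[ℝ] ℝ)} {m : ℕ}
    {b : Module.Basis (Fin m × Fin 2) ℝ 𝔱} {I : Alg d G →L[ℝ] Alg d G} :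
    HasSamelsonAction P b I ↔ IsSamelson P b (I : Alg d G →ₗ[ℝ] Alg d G) := by
  constructor
  · intro h
    refine ⟨fun α hα X Y hXY => ?_, h.fst, h.snd⟩
    obtain ⟨E, rfl, rfl⟩ := exists_tensor X Y
    have h1 := congrArg tensorRe (h.pos α hα E (isRootVector_iff.2 hXY))
    rw [tensorRe_baseChange, tensorRe_smul] at h1
    simpa using h1
  · intro h
    have hpair : ∀ α ∈ P, ∀ X Y : Alg d G, IsRootPair 𝔱 α X Y → I X = Y ∧ I Y = -X :=
      fun α hα X Y hXY => ⟨h.root α hα X Y hXY, h.root α hα Y (-X) hXY.rotate⟩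
    refine ⟨fun α hα E hE => ?_, fun α hα E hE => ?_, h.fst, h.snd⟩
    · obtain ⟨h1, h2⟩ := hpair α hα _ _ (isRootVector_iff.1 hE)
      rw [tensor_ext_iff, tensorRe_baseChange, tensorIm_baseChange, tensorRe_smul, tensorIm_smul]
      simp [h1, h2]
    · have h0 := (isRootVector_iff.1 hE).conj
      rw [neg_neg] at h0
      obtain ⟨h1, h2⟩ := hpair α hα _ _ h0
      rw [map_neg, neg_inj] at h2
      rw [tensor_ext_iff, tensorRe_baseChange, tensorIm_baseChange, tensorRe_smul, tensorIm_smul]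
      simp [h1, h2]

end Roots

end Samelson

/-! ### The main theorem. -/

theorem mainTheorem3 {d : ℕ} (hd : Even d) {G : Type*} [TopologicalSpace G]
    [ChartedSpace (Samelson.Model d) G] [Group G] [LieGroup (𝓡 d) ∞ G] [T2Space G]
    [CompactSpace G] {N : ℕ} (ρ : G →* Matrix.unitaryGroup (Fin N) ℂ)
    (hρ : Samelson.IsFaithfulRep (d := d) ρ) (C : ℝ) (hC : 0 < C) :
    ∃ g : Samelson.Metric d G, Samelson.IsKillingMetric ρ C g ∧
      (∀ J : Samelson.EndField d G, Samelson.IsLeftInvariant J → Samelson.IsAlmostHermitian g J →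
        (Samelson.NijenhuisVanishes J ↔ Samelson.StructureIdentity g (J 1))) ∧
      ∃ B : Samelson.Connection d G,
        Samelson.IsBismutConnection g (Samelson.structureTensor g) B ∧
        (∃ 𝔱 : LieSubalgebra ℝ (Samelson.Alg d G), 𝔱.IsCartanSubalgebra) ∧
        ∀ 𝔱 : LieSubalgebra ℝ (Samelson.Alg d G), 𝔱.IsCartanSubalgebra →
          (∃ P : Set (𝔱 →ₗ[ℝ] ℝ), Samelson.IsPositiveSystem 𝔱 P) ∧
          (∃ (m : ℕ) (b : Module.Basis (Fin m × Fin 2) ℝ 𝔱), Samelson.IsOrthonormalPairs g b) ∧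
          ∀ P : Set (𝔱 →ₗ[ℝ] ℝ), Samelson.IsPositiveSystem 𝔱 P →
          ∀ (m : ℕ) (b : Module.Basis (Fin m × Fin 2) ℝ 𝔱), Samelson.IsOrthonormalPairs g b →
            (∃! J : Samelson.EndField d G,
              Samelson.IsLeftInvariant J ∧ Samelson.HasSamelsonAction P b (J 1)) ∧
            ∀ J : Samelson.EndField d G,
              Samelson.IsLeftInvariant J → Samelson.HasSamelsonAction P b (J 1) →
                Samelson.IsComplexStructure g J ∧ Samelson.IsParallel B J ∧
                Samelson.StructureIdentity g (J 1) := by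
  have hκ := hρ.killingForm_isInvariantInner hC
  set κ := Samelson.killingForm (d := d) ρ C
  refine ⟨Samelson.leftMetric κ hκ, hρ.isKillingMetric hC, fun J hJ hH => ?_,
    Samelson.leftConnection d G, Samelson.isBismutConnection_leftConnection hκ, ?_,
    fun 𝔱 h𝔱 => ⟨?_, ?_, fun P hP m b hb => ?_⟩⟩
  · rw [hJ.nijenhuisVanishes_iff (hH.sq 1), Samelson.structureIdentity_iff hκ]
    intro v w
    have h1 := hH.skew 1 v w
    rwa [Samelson.leftMetric_inner_one, Samelson.leftMetric_inner_one] at h1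
  · obtain ⟨x, hx⟩ := LieAlgebra.exists_isCartanSubalgebra_engel ℝ (Samelson.Alg d G)
    exact ⟨_, hx⟩
  · obtain ⟨P, hP⟩ := Samelson.exists_isPositiveRootSet 𝔱
    exact ⟨P, Samelson.isPositiveSystem_iff.2 hP⟩
  · obtain ⟨m, b, hb⟩ := Samelson.exists_orthonormal_pairs_cartan hκ h𝔱
      (by rwa [Samelson.finrank_alg])
    exact ⟨m, b, fun p q => (Samelson.leftMetric_inner_one κ hκ _ _).trans (hb p q)⟩
  · have hP' := Samelson.isPositiveSystem_iff.1 hP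
    have hb' : ∀ p q, κ (b p : Samelson.Alg d G) (b q : Samelson.Alg d G)
        = if p = q then 1 else 0 := fun p q =>
      (Samelson.leftMetric_inner_one κ hκ _ _).symm.trans (hb p q)
    refine ⟨?_, fun J hJ hS => ?_⟩
    · obtain ⟨I, hI⟩ := Samelson.exists_isSamelson hκ h𝔱 hP' hb'
      let I' : Samelson.Alg d G →L[ℝ] Samelson.Alg d G :=
        ⟨I, Samelson.continuous_endAlg I⟩
      refine ⟨Samelson.leftEndField I', ⟨Samelson.isLeftInvariant_leftEndField I', ?_⟩, ?_⟩
      · rw [Samelson.leftEndField_one]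
        exact Samelson.hasSamelsonAction_iff.2 hI
      · rintro J ⟨hJ, hS⟩
        have h1 : J 1 = I' := ContinuousLinearMap.ext fun v => LinearMap.congr_fun
          ((Samelson.hasSamelsonAction_iff.1 hS).unique hκ h𝔱 hP' hI) v
        rw [hJ.eq_leftEndField, h1]
    · have hS' := Samelson.hasSamelsonAction_iff.1 hS
      have hsq : ∀ v : Samelson.Alg d G, J 1 (J 1 v) = -v := hS'.sq hκ h𝔱 hP'
      have hskew : ∀ v w : Samelson.Alg d G, κ (J 1 v) w = - κ v (J 1 w) := fun v w => by
        -- `J 1` is an isometry; with `J 1 w` in the second slot, squaring to -1 turns this into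
        -- skewness.
        have h1 : κ (J 1 v) (J 1 (J 1 w)) = κ v (J 1 w) := hS'.inner_map hκ h𝔱 hP' hb' v (J 1 w)
        rw [← h1, hsq, map_neg, neg_neg]
      have hN := hS'.nijenhuis hκ h𝔱 hP'
      exact ⟨⟨Samelson.isAlmostHermitian_of_isLeftInvariant hκ hJ hsq hskew,
        (hJ.nijenhuisVanishes_iff hsq).2 hN⟩, hJ.isParallel,
        (Samelson.structureIdentity_iff hκ hskew).2 hN⟩
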